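/- Let $\mathbb{T}$ be the unit circle, let $\mathcal{C}^\infty(\mathbb{T})$ be the Fréchet space of smooth complex functions on $\mathbb{T}$, with the topology defined by the norms $\rho_\nu(f)=\sum_{n\in\mathbb{Z}}|\hat f(n)|(1+|n|)^\nu$ ($\nu\ge 0$ real), and let $\mathcal{D}'(\mathbb{T})$ be its topological dual, the space of distributions on $\mathbb{T}$. With $\alpha(z)=z$, put $\hat T(n)=\langle \alpha^{-n},T\rangle$ for $T\in\mathcal{D}'(\mathbb{T})$, $n\in\mathbb{Z}$. Let $a^\infty\subset\mathcal{C}^\infty(\mathbb{T})$ be the space of those smooth functions on $\mathbb{T}$ that extend to a continuous function on the closed unit disc which is holomorphic in the open disc. For a closed set $E\subset\mathbb{T}$ let $$I_\infty(E)=\{f\in\mathcal{C}^\infty(\mathbb{T}) : f^{(i)}=0 \text{ on } E \text{ for all } i\ge 0\},\qquad I_\infty^+(E)=I_\infty(E)\cap a^\infty,$$ where $f^{(i)}$ denotes the $i$-th derivative with respect to $z\in\mathbb{T}$. For a subspace $V$ of $\mathcal{C}^\infty(\mathbb{T})$ let $V^\perp$ be the set of distributions that vanish on $V$. Consider the following properties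 of $E$. (i) $E$ is an interpolation set for $a^\infty$: for every $f\in\mathcal{C}^\infty(\mathbb{T})$ there is $g\in a^\infty$ with $f^{(i)}=g^{(i)}$ on $E$ for all $i\ge 0$. (ii) $I_\infty^+(E)^\perp=I_\infty(E)^\perp+(a^\infty)^\perp$. (iii) For every real $s\ge 0$ there are constants $C>0$ and $t\ge 0$ such that $$\sup_{n\in\mathbb{Z}}\frac{|\hat T(n)|}{(1+|n|)^t}\le C\,\sup_{n\le 0}\frac{|\hat T(n)|}{(1+|n|)^s}\qquad\text{for all } T\in I_\infty(E)^\perp,$$ where the suprema are taken in $[0,+\infty]$. Then, for every closed set $E\subset\mathbb{T}$, (i) is equivalent to (iii), and (i) implies (ii). If moreover $E\ne\mathbb{T}$, then (ii) implies (i), so that the three properties are equivalent. -/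

import Mathlib

open Set MeasureTheory
open scoped Real NNReal ENNReal Manifold ContDiff

namespace CircleInterp

/-- The space of complex functions on the unit circle that are smooth on the manifold `Circle`. -/
def smoothSubmodule : Submodule ℂ (Circle → ℂ) where
  carrier := {f | ContMDiff (𝓡 1) 𝓘(ℝ, ℂ) ∞ f}
  add_mem' := fun hf hg => ContMDiff.add hf hg
  zero_mem' := contMDiff_const
  smul_mem' := fun c f hf => by
    have h : ContDiff ℝ ∞ (fun z : ℂ => c * z) := contDiff_const.mul contDiff_id
    exact h.contMDiff.comp hf

/-- The space `C^∞(𝕋)`. It is a type of its own, so that it does not inherit the topology of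
pointwise convergence; its Fréchet topology is given below. -/
def Smooth : Type := smoothSubmodule

namespace Smooth

noncomputable instance : AddCommGroup Smooth := inferInstanceAs (AddCommGroup smoothSubmodule)

noncomputable instance : Module ℂ Smooth := inferInstanceAs (Module ℂ smoothSubmodule)

instance : CoeFun Smooth (fun _ => Circle → ℂ) := ⟨fun f => f.1⟩

theorem ext {f g : Smooth} (h : ∀ z, f z = g z) : f = g := Subtype.ext (funext h)

theorem add_apply (f g : Smooth) (z : Circle) : (f + g) z = f z + g z := rfl

theorem smul_apply (c : ℂ) (f : Smooth) (z : Circle) : (c • f) z = c * f z := rfl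

theorem zero_apply (z : Circle) : (0 : Smooth) z = 0 := rfl

theorem contMDiff (f : Smooth) : ContMDiff (𝓡 1) 𝓘(ℝ, ℂ) ∞ (f : Circle → ℂ) := f.2

end Smooth

/-- A function on the circle is smooth iff it is a smooth function of the angle. -/
theorem contMDiff_iff_contDiff_exp (f : Circle → ℂ) :
    ContMDiff (𝓡 1) 𝓘(ℝ, ℂ) ∞ f ↔ ContDiff ℝ ∞ (fun t : ℝ => f (Circle.exp t)) := by
  constructor
  · intro h
    exact (h.comp contMDiff_circleExp).contDiff
  · intro h z₀
    obtain ⟨θ, hθ⟩ : ∃ θ : ℝ, Circle.exp θ = z₀ := ⟨_, Circle.exp_arg z₀⟩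
    let φ : ℂ → ℝ := fun w => θ + (Complex.log (w / (z₀ : ℂ))).im
    have hz₀ : (z₀ : ℂ) ≠ 0 := Circle.coe_ne_zero z₀
    have hφ : ContDiffAt ℝ ∞ φ (z₀ : ℂ) := by
      have h1 : ContDiffAt ℝ ∞ (fun w : ℂ => w / (z₀ : ℂ)) (z₀ : ℂ) :=
        contDiffAt_id.div_const _
      have h2 : ContDiffAt ℝ ∞ Complex.log ((z₀ : ℂ) / (z₀ : ℂ)) := by
        refine (Complex.contDiffAt_log ?_).restrict_scalars ℝ
        rw [div_self hz₀]; exact Complex.one_mem_slitPlane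
      have h3 : ContDiffAt ℝ ∞ (fun w : ℂ => Complex.log (w / (z₀ : ℂ))) (z₀ : ℂ) :=
        ContDiffAt.comp (g := Complex.log) (z₀ : ℂ) h2 h1
      have h4 : ContDiffAt ℝ ∞ (fun w : ℂ => (Complex.log (w / (z₀ : ℂ))).im) (z₀ : ℂ) :=
        Complex.imCLM.contDiff.contDiffAt.comp (z₀ : ℂ) h3
      exact contDiffAt_const.add h4
    have hc : ContMDiff (𝓡 1) 𝓘(ℝ, ℂ) ∞ (fun z : Circle => (z : ℂ)) :=
      haveI := Fact.mk Complex.finrank_real_complex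
      contMDiff_coe_sphere
    have hcomp : ContMDiffAt (𝓡 1) 𝓘(ℝ, ℂ) ∞
        (fun z : Circle => f (Circle.exp (φ (z : ℂ)))) z₀ :=
      (h.contDiffAt.comp (z₀ : ℂ) hφ).contMDiffAt.comp z₀ hc.contMDiffAt
    convert hcomp using 1
    funext z
    congr 1
    have : Circle.exp (φ z) = Circle.exp θ * Circle.exp (Complex.arg ((z / z₀ : Circle) : ℂ)) := by
      rw [← Circle.exp_add]; simp [φ, Complex.log_im]
    rw [this, Circle.exp_arg, hθ]
    simp

namespace Smooth

theorem contDiff_exp (f : Smooth) : ContDiff ℝ ∞ (fun t : ℝ => f (Circle.exp t)) :=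
  (contMDiff_iff_contDiff_exp _).1 f.2

theorem continuous (f : Smooth) : Continuous (f : Circle → ℂ) := f.contMDiff.continuous

end Smooth

/-- The derivative of a function on the circle with respect to the variable `z ∈ 𝕋`:
as `z` moves along `t ↦ z * exp (i t)`, this is `(df/dt) / (dz/dt)` with `dz/dt = i z` at `t = 0`.
In particular the derivative of `z ^ n` is `n * z ^ (n - 1)`. -/
noncomputable def circleDeriv (f : Circle → ℂ) (z : Circle) : ℂ :=
  deriv (fun t : ℝ => f (z * Circle.exp t)) 0 / (Complex.I * z)

theorem circleDeriv_exp (f : Circle → ℂ) (s : ℝ) :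
    circleDeriv f (Circle.exp s) =
      deriv (fun t : ℝ => f (Circle.exp t)) s / (Complex.I * Circle.exp s) := by
  unfold circleDeriv
  congr 1
  have := deriv_comp_const_add (f := fun t : ℝ => f (Circle.exp t)) s 0
  simpa [Circle.exp_add] using this

theorem Smooth.differentiableAt (f : Smooth) (z : Circle) :
    DifferentiableAt ℝ (fun t : ℝ => f (z * Circle.exp t)) 0 := by
  obtain ⟨θ, rfl⟩ : ∃ θ : ℝ, Circle.exp θ = z := ⟨_, Circle.exp_arg z⟩
  have h : Differentiable ℝ (fun t : ℝ => f (Circle.exp t)) := f.contDiff_exp.differentiable (by simp)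
  have := (h.comp (differentiable_id.const_add θ)).differentiableAt (x := (0 : ℝ))
  simpa [Function.comp_def, Circle.exp_add] using this

/-- The derivative `f ↦ f'` as a linear map of `C^∞(𝕋)`. -/
noncomputable def D : Smooth →ₗ[ℂ] Smooth where
  toFun f := ⟨circleDeriv f, by
    refine (contMDiff_iff_contDiff_exp _).2 ?_
    simp only [circleDeriv_exp]
    have h1 : ContDiff ℝ ∞ (deriv (fun t : ℝ => f (Circle.exp t))) :=
      (contDiff_infty_iff_deriv.1 f.contDiff_exp).2
    have h2 : ContDiff ℝ ∞ (fun t : ℝ => Complex.I * (Circle.exp t : ℂ)) := by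
      simp only [Circle.coe_exp]
      have h0 : ContDiff ℝ ∞ (fun t : ℝ => (t : ℂ)) := Complex.ofRealCLM.contDiff
      fun_prop
    simp only [div_eq_mul_inv]
    exact h1.mul (h2.inv fun t => mul_ne_zero Complex.I_ne_zero (Circle.coe_ne_zero _))⟩
  map_add' f g := by
    refine Smooth.ext fun z => ?_
    change circleDeriv (f + g) z = circleDeriv f z + circleDeriv g z
    unfold circleDeriv
    rw [← add_div, ← deriv_fun_add (f.differentiableAt z) (g.differentiableAt z)]
    rfl
  map_smul' c f := by
    refine Smooth.ext fun z => ?_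
    change circleDeriv (c • f) z = c * circleDeriv f z
    unfold circleDeriv
    rw [← mul_div_assoc, ← deriv_const_mul c (f.differentiableAt z)]
    rfl

theorem D_apply (f : Smooth) (z : Circle) : D f z = circleDeriv f z := rfl

/-- The Fourier coefficient `f̂(n) = (1/2π) ∫ f(e^{it}) e^{-int} dt`. -/
noncomputable def coeff (f : Circle → ℂ) (n : ℤ) : ℂ :=
  haveI : Fact (0 < 2 * π) := ⟨Real.two_pi_pos⟩
  fourierCoeff (fun x : AddCircle (2 * π) => f x.toCircle) n

theorem coeff_eq_integral (f : Circle → ℂ) (n : ℤ) :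
    coeff f n = (1 / (2 * π) : ℝ) •
      ∫ t in (0 : ℝ)..(2 * π), Complex.exp (-(n * t * Complex.I)) * f (Circle.exp t) := by
  have : Fact (0 < 2 * π) := ⟨Real.two_pi_pos⟩
  have hpi : (π : ℂ) ≠ 0 := by exact_mod_cast Real.pi_ne_zero
  unfold coeff
  rw [fourierCoeff_eq_intervalIntegral _ n 0, zero_add]
  congr 1
  refine intervalIntegral.integral_congr fun t _ => ?_
  simp only [fourier_coe_apply, AddCircle.toCircle_apply_mk, smul_eq_mul]
  rw [div_self (by positivity), one_mul]
  congr 2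
  push_cast
  field_simp

theorem intervalIntegrable_coeff (f : Smooth) (n : ℤ) (a b : ℝ) :
    IntervalIntegrable (fun t : ℝ => Complex.exp (-(n * t * Complex.I)) * f (Circle.exp t))
      volume a b := by
  apply Continuous.intervalIntegrable
  have h1 := f.contDiff_exp.continuous
  have h2 : Continuous (fun t : ℝ => Complex.exp (-(n * t * Complex.I))) := by fun_prop
  exact h2.mul h1

theorem coeff_add (f g : Smooth) (n : ℤ) : coeff (f + g : Smooth) n = coeff f n + coeff g n := by
  simp only [coeff_eq_integral, Smooth.add_apply, mul_add]
  rw [intervalIntegral.integral_add (intervalIntegrable_coeff f n _ _)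
    (intervalIntegrable_coeff g n _ _), smul_add]

theorem coeff_smul (c : ℂ) (f : Smooth) (n : ℤ) : coeff (c • f : Smooth) n = c * coeff f n := by
  simp only [coeff_eq_integral, Smooth.smul_apply, mul_left_comm _ c,
    intervalIntegral.integral_const_mul, mul_smul_comm]

/-- The relation `(f')^(n) = (n + 1) f̂(n + 1)`. -/
theorem coeff_D (f : Smooth) (n : ℤ) : coeff (D f) n = (n + 1) * coeff f (n + 1) := by
  have hf := f.contDiff_exp
  have hd : ∀ t : ℝ, HasDerivAt
      (fun t : ℝ => Complex.exp (-(((n + 1 : ℤ) : ℂ) * t * Complex.I)) * f (Circle.exp t))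
      (Complex.I * (Complex.exp (-(n * t * Complex.I)) * D f (Circle.exp t)) -
        Complex.I * (n + 1) *
          (Complex.exp (-(((n + 1 : ℤ) : ℂ) * t * Complex.I)) * f (Circle.exp t))) t := by
    intro t
    have h1 : HasDerivAt (fun t : ℝ => Complex.exp (-(((n + 1 : ℤ) : ℂ) * t * Complex.I)))
        (Complex.exp (-(((n + 1 : ℤ) : ℂ) * t * Complex.I)) *
          (-(((n + 1 : ℤ) : ℂ) * 1 * Complex.I))) t :=
      ((((Complex.ofRealCLM.hasDerivAt (x := t)).const_mul _).mul_const Complex.I).neg).cexp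
    have h2 := ((hf.differentiable (by simp)) t).hasDerivAt
    refine (h1.mul h2).congr_deriv ?_
    rw [D_apply, circleDeriv_exp, Circle.coe_exp]
    have he : Complex.exp (-(((n + 1 : ℤ) : ℂ) * t * Complex.I)) =
        Complex.exp (-(n * t * Complex.I)) / Complex.exp (t * Complex.I) := by
      rw [← Complex.exp_sub]; congr 1; push_cast; ring
    rw [he]
    have := Complex.exp_ne_zero (t * Complex.I)
    have := Complex.I_ne_zero
    push_cast
    field_simp
    ring
  have hint := intervalIntegral.integral_eq_sub_of_hasDerivAt (a := 0) (b := 2 * π)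
    (fun t _ => hd t) (((intervalIntegrable_coeff (D f) n _ _).const_mul _).sub
      ((intervalIntegrable_coeff f (n + 1) _ _).const_mul _))
  rw [intervalIntegral.integral_sub ((intervalIntegrable_coeff (D f) n _ _).const_mul _)
      ((intervalIntegrable_coeff f (n + 1) _ _).const_mul _),
    intervalIntegral.integral_const_mul, intervalIntegral.integral_const_mul] at hint
  have hper : Complex.exp (-(((n + 1 : ℤ) : ℂ) * ((2 * π : ℝ) : ℂ) * Complex.I)) = 1 := by
    rw [Complex.exp_eq_one_iff]
    exact ⟨-(n + 1), by push_cast; ring⟩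
  rw [hper] at hint
  simp only [Circle.exp_two_pi, Circle.exp_zero, Complex.ofReal_zero, mul_zero, zero_mul, neg_zero,
    Complex.exp_zero, sub_self] at hint
  rw [mul_assoc, ← mul_sub, mul_eq_zero] at hint
  have h := sub_eq_zero.1 (hint.resolve_left Complex.I_ne_zero)
  rw [coeff_eq_integral, coeff_eq_integral, h, mul_smul_comm]

theorem exists_coeff_bound (k : ℕ) (f : Smooth) :
    ∃ C : ℝ, ∀ n : ℤ, ‖coeff f n‖ * (1 + |(n : ℝ)|) ^ k ≤ C := by
  induction k generalizing f with
  | zero =>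
    obtain ⟨M, hM⟩ := isCompact_univ.exists_bound_of_continuousOn f.continuous.continuousOn
    refine ⟨M, fun n => ?_⟩
    rw [pow_zero, mul_one, coeff_eq_integral, norm_smul]
    have h := intervalIntegral.norm_integral_le_of_norm_le_const (a := 0) (b := 2 * π) (C := M)
      (f := fun t : ℝ => Complex.exp (-(n * t * Complex.I)) * f (Circle.exp t)) (fun t _ => by
        rw [norm_mul]
        have : ‖Complex.exp (-(n * t * Complex.I))‖ = 1 := by
          rw [Complex.norm_exp]; simp
        rw [this, one_mul]
        exact hM _ (mem_univ _))
    have hpi := Real.two_pi_pos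
    rw [sub_zero, abs_of_pos hpi] at h
    rw [Real.norm_of_nonneg (by positivity)]
    calc _ ≤ 1 / (2 * π) * (M * (2 * π)) := by gcongr
      _ = M := by field_simp
  | succ k ih =>
    obtain ⟨A, hA⟩ := ih f
    obtain ⟨B, hB⟩ := ih (D f)
    refine ⟨A + 2 ^ k * B, fun n => ?_⟩
    have h1 := hB (n - 1)
    rw [coeff_D] at h1
    rw [sub_add_cancel] at h1
    have h2 : ((n - 1 : ℤ) : ℂ) + 1 = n := by push_cast; ring
    rw [h2, norm_mul, Complex.norm_intCast] at h1
    have h3 : 1 + |(n : ℝ)| ≤ 2 * (1 + |((n - 1 : ℤ) : ℝ)|) := by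
      have := abs_add_le ((n : ℝ) - 1) 1
      have h0 := abs_nonneg ((n : ℝ) - 1)
      simp only [sub_add_cancel, abs_one] at this
      push_cast
      linarith
    have h4 : (1 + |(n : ℝ)|) ^ k ≤ 2 ^ k * (1 + |((n - 1 : ℤ) : ℝ)|) ^ k := by
      rw [← mul_pow]; gcongr
    calc ‖coeff f n‖ * (1 + |(n : ℝ)|) ^ (k + 1)
        = ‖coeff f n‖ * (1 + |(n : ℝ)|) ^ k +
            |(n : ℝ)| * ‖coeff f n‖ * (1 + |(n : ℝ)|) ^ k := by ring
      _ ≤ A + |(n : ℝ)| * ‖coeff f n‖ * (2 ^ k * (1 + |((n - 1 : ℤ) : ℝ)|) ^ k) := by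
          gcongr
          exact hA n
      _ = A + 2 ^ k * (|(n : ℝ)| * ‖coeff f n‖ * (1 + |((n - 1 : ℤ) : ℝ)|) ^ k) := by ring
      _ ≤ A + 2 ^ k * B := by gcongr

theorem summable_rho (ν : ℝ≥0) (f : Smooth) :
    Summable (fun n : ℤ => ‖coeff f n‖ * (1 + |(n : ℝ)|) ^ (ν : ℝ)) := by
  obtain ⟨k, hk⟩ := exists_nat_ge (ν : ℝ)
  obtain ⟨C, hC⟩ := exists_coeff_bound (k + 2) f
  have hs : Summable (fun n : ℤ => C * (1 / |(n : ℝ)| ^ (2 : ℝ))) :=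
    (Real.summable_abs_int_rpow (b := 2) (by norm_num)).mul_left C |>.congr fun n => by
      rw [Real.rpow_neg (abs_nonneg _), one_div]
  refine Summable.of_norm_bounded_eventually hs ?_
  filter_upwards [(Set.finite_singleton (0 : ℤ)).compl_mem_cofinite] with n hn
  have hn0 : (0 : ℝ) < |(n : ℝ)| := abs_pos.2 (by exact_mod_cast hn)
  have hb : (1 : ℝ) ≤ 1 + |(n : ℝ)| := by linarith
  rw [Real.norm_of_nonneg (by positivity), mul_one_div, le_div_iff₀ (by positivity)]
  refine le_trans ?_ (hC n)
  rw [mul_assoc, pow_add]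
  gcongr
  · rw [← Real.rpow_natCast]
    exact Real.rpow_le_rpow_of_exponent_le hb hk
  · rw [Real.rpow_two]
    gcongr
    linarith

/-- The norms `ρ_ν(f) = ∑ |f̂(n)| (1 + |n|)^ν`, for `ν ≥ 0` real. -/
noncomputable def rho : SeminormFamily ℂ Smooth ℝ≥0 := fun ν =>
  Seminorm.of (fun f => ∑' n : ℤ, ‖coeff f n‖ * (1 + |(n : ℝ)|) ^ (ν : ℝ))
    (fun f g => by
      rw [← (summable_rho ν f).tsum_add (summable_rho ν g)]
      refine (summable_rho ν (f + g)).tsum_le_tsum (fun n => ?_)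
        ((summable_rho ν f).add (summable_rho ν g))
      rw [coeff_add, ← add_mul]
      gcongr
      exact norm_add_le _ _)
    (fun c f => by
      rw [← tsum_mul_left]
      refine tsum_congr fun n => ?_
      rw [coeff_smul, norm_mul, mul_assoc])

/-- The Fréchet topology of `C^∞(𝕋)`, defined by the norms `ρ_ν`. -/
noncomputable instance : TopologicalSpace Smooth := rho.moduleFilterBasis.topology

theorem withSeminorms_rho : WithSeminorms rho := ⟨rfl⟩

/-- Distributions on the circle: the topological dual of `C^∞(𝕋)`. -/
abbrev Distribution : Type := Smooth →L[ℂ] ℂ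

/-- The function `α ^ n`, where `α : z ↦ z`. -/
noncomputable def alphaPow (n : ℤ) : Smooth :=
  ⟨fun z => (z : ℂ) ^ n, (contMDiff_iff_contDiff_exp _).2 (by
    have h : (fun t : ℝ => ((Circle.exp t : Circle) : ℂ) ^ n) =
        fun t : ℝ => Complex.exp (n * (t * Complex.I)) := by
      funext t; rw [Circle.coe_exp, ← Complex.exp_int_mul]
    rw [h]
    have h0 : ContDiff ℝ ∞ (fun t : ℝ => (t : ℂ)) := Complex.ofRealCLM.contDiff
    fun_prop)⟩

/-- The Fourier coefficient `T̂(n) = ⟨α ^ (-n), T⟩` of a distribution. -/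
noncomputable def distCoeff (T : Distribution) (n : ℤ) : ℂ := T (alphaPow (-n))

/-- The space `a^∞`: the smooth functions on the circle that extend to a continuous function on the
closed unit disc, holomorphic in the open disc. -/
def aInf : Submodule ℂ Smooth where
  carrier := {f | ∃ F : ℂ → ℂ, DiffContOnCl ℂ F (Metric.ball 0 1) ∧ ∀ z : Circle, F z = f z}
  add_mem' := by
    rintro f g ⟨F, hF, hf⟩ ⟨G, hG, hg⟩
    exact ⟨F + G, hF.add hG, fun z => by rw [Pi.add_apply, hf, hg, Smooth.add_apply]⟩
  zero_mem' := ⟨fun _ => 0, diffContOnCl_const, fun _ => rfl⟩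
  smul_mem' := by
    rintro c f ⟨F, hF, hf⟩
    exact ⟨c • F, hF.const_smul c, fun z => by
      rw [Pi.smul_apply, hf, Smooth.smul_apply, smul_eq_mul]⟩

/-- `I_∞(E)`: the smooth functions all of whose derivatives (of order `≥ 0`) vanish on `E`. -/
def idealInf (E : Set Circle) : Submodule ℂ Smooth where
  carrier := {f | ∀ i : ℕ, ∀ z ∈ E, (D ^ i) f z = 0}
  add_mem' := fun hf hg i z hz => by
    rw [map_add, Smooth.add_apply, hf i z hz, hg i z hz, add_zero]
  zero_mem' := fun i z _ => by rw [map_zero, Smooth.zero_apply]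
  smul_mem' := fun c f hf i z hz => by
    rw [map_smul, Smooth.smul_apply, hf i z hz, mul_zero]

/-- `I_∞^+(E) = I_∞(E) ∩ a^∞`. -/
noncomputable def idealInfPlus (E : Set Circle) : Submodule ℂ Smooth := idealInf E ⊓ aInf

/-- `V^⊥`: the distributions that vanish on `V`. -/
def annihilator (V : Submodule ℂ Smooth) : Submodule ℂ Distribution where
  carrier := {T | ∀ f ∈ V, T f = 0}
  add_mem' := fun hS hT f hf => by
    rw [_root_.add_apply, hS f hf, hT f hf, add_zero]
  zero_mem' := fun _ _ => rfl
  smul_mem' := fun c T hT f hf => by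
    rw [_root_.smul_apply, hT f hf, smul_zero]

/-- `E` is an interpolation set for `a^∞`: for every `f ∈ C^∞(𝕋)` there is `g ∈ a^∞` whose
derivatives of all orders `≥ 0` agree on `E` with those of `f`. -/
def IsInterpolationSet (E : Set Circle) : Prop :=
  ∀ f : Smooth, ∃ g ∈ aInf, ∀ i : ℕ, ∀ z ∈ E, (D ^ i) f z = (D ^ i) g z

/-- `I_∞^+(E)^⊥ = I_∞(E)^⊥ + (a^∞)^⊥`. -/
def AnnihilatorSplits (E : Set Circle) : Prop :=
  annihilator (idealInfPlus E) = annihilator (idealInf E) ⊔ annihilator aInf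

/-- For every `s ≥ 0` there are `C > 0` and `t ≥ 0` with
`sup_{n ∈ ℤ} |T̂(n)| / (1 + |n|)^t ≤ C sup_{n ≤ 0} |T̂(n)| / (1 + |n|)^s` for all `T ∈ I_∞(E)^⊥`.
The suprema are taken in `[0, ∞]`; the right-hand side may be infinite. -/
def CoeffEstimate (E : Set Circle) : Prop :=
  ∀ s : ℝ, 0 ≤ s → ∃ C : ℝ, 0 < C ∧ ∃ t : ℝ, 0 ≤ t ∧ ∀ T ∈ annihilator (idealInf E),
    (⨆ n : ℤ, ENNReal.ofReal (‖distCoeff T n‖ / (1 + |(n : ℝ)|) ^ t)) ≤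
      ENNReal.ofReal C *
        ⨆ (n : ℤ) (_ : n ≤ 0), ENNReal.ofReal (‖distCoeff T n‖ / (1 + |(n : ℝ)|) ^ s)

end CircleInterp

open Filter Topology

namespace CircleInterp

/-! ### Fourier series of smooth functions -/

/-! Everything is read off Fourier coefficients: smooth functions are the rapidly decreasing
sequences, distributions T are the sequences T(z^n) of polynomial growth, a^∞ consists of the
functions without negative coefficients, and (a^∞)^⊥ of the T with T(z^n) = 0 for n ≥ 0. Since T̂(n)
= T(z^(-n)), the right side of (iii) sees only the restriction of T to a^∞. Property (i) says that
C^∞ = a^∞ + I_∞(E), a sum of two closed subspaces of a Fréchet space.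

Under (i), the open mapping theorem (`exists_bounded_decomposition`) writes f = a + i with ρ_s(a) ≤
C ρ_t(f). If T kills I_∞(E), then T(z^n) = T(a) is bounded through the T(z^m) with m ≥ 0, which is
(iii). If T kills only I_∞^+(E), then f ↦ T(a) is well defined and continuous, kills I_∞(E) and
agrees with T on a^∞, which is (ii).

Conversely, (iii) is the dual form of a bounded decomposition: Hahn–Banach yields approximate
decompositions with a bound, and successive approximation makes them exact
(`exists_decomposition_of_approximate`).

For (ii) ⟹ (iii), Baire's theorem on a compact convex set of coefficient sequences makes the
splitting quantitative (`AnnihilatorSplits.exists_dualBall`). It bounds some element of I_∞(E)^⊥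
with the given coefficients of index n ≥ 0; this element is T itself because I_∞(E)^⊥ ∩ (a^∞)^⊥ = 0
(`eq_zero_of_mem_annihilators`). Only here is E ≠ 𝕋 needed: for E = 𝕋 one has I_∞(E) = 0, so (ii)
holds trivially while (i) fails. -/

theorem one_le_one_add_abs (n : ℤ) : (1 : ℝ) ≤ 1 + |(n : ℝ)| := by
  linarith [abs_nonneg (n : ℝ)]

theorem norm_circle_zpow (z : Circle) (n : ℤ) : ‖(z : ℂ) ^ n‖ = 1 := by
  rw [norm_zpow, Circle.norm_coe, one_zpow]

theorem summable_norm_coeff (f : Smooth) : Summable (fun n : ℤ => ‖coeff f n‖) := by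
  simpa using summable_rho 0 f

theorem hasSum_coeff_mul_zpow (f : Smooth) (z : Circle) :
    HasSum (fun n : ℤ => coeff f n * (z : ℂ) ^ n) (f z) := by
  have : Fact (0 < 2 * π) := ⟨Real.two_pi_pos⟩
  let F : C(AddCircle (2 * π), ℂ) :=
    ⟨fun x => f x.toCircle, f.continuous.comp AddCircle.continuous_toCircle⟩
  have hF : Summable (fourierCoeff F) := (summable_norm_coeff f).of_norm
  obtain ⟨θ, rfl⟩ : ∃ θ : ℝ, Circle.exp θ = z := ⟨_, Circle.exp_arg z⟩
  have hx : AddCircle.toCircle (θ : AddCircle (2 * π)) = Circle.exp θ := by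
    rw [AddCircle.toCircle_apply_mk, div_self Real.two_pi_pos.ne', one_mul]
  rw [← hx]
  have h := has_pointwise_sum_fourier_series_of_summable hF (θ : AddCircle (2 * π))
  refine h.congr_fun fun n => ?_
  simp only [fourier_apply, AddCircle.toCircle_zsmul, smul_eq_mul]
  rfl

theorem Smooth.ext_coeff {f g : Smooth} (h : ∀ n, coeff f n = coeff g n) : f = g :=
  Smooth.ext fun z => (hasSum_coeff_mul_zpow f z).unique <| by
    simpa only [h] using hasSum_coeff_mul_zpow g z

theorem coeff_zpow (m n : ℤ) : coeff (fun z => (z : ℂ) ^ m) n = if n = m then 1 else 0 := by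
  have : Fact (0 < 2 * π) := ⟨Real.two_pi_pos⟩
  have h : (fun x : AddCircle (2 * π) => ((x.toCircle : Circle) : ℂ) ^ m) = fourier m := by
    funext x
    simp [fourier_apply, AddCircle.toCircle_zsmul]
  rw [coeff, h, fourierCoeff_fourier, Pi.single_apply]

theorem coeff_alphaPow (m n : ℤ) : coeff (alphaPow m) n = if n = m then 1 else 0 :=
  coeff_zpow m n

/-- The Fourier coefficients of an absolutely convergent trigonometric series. -/
theorem coeff_of_hasSum {c : ℤ → ℂ} (hc : Summable fun n => ‖c n‖) {f : Circle → ℂ}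
    (hf : ∀ z : Circle, HasSum (fun n : ℤ => c n * (z : ℂ) ^ n) (f z)) (m : ℤ) :
    coeff f m = c m := by
  have : Fact (0 < 2 * π) := ⟨Real.two_pi_pos⟩
  have h1 : ∀ n, Continuous fun t : AddCircle (2 * π) =>
      fourier (-m) t • (c n * ((t.toCircle : Circle) : ℂ) ^ n) := fun n => by
    refine (map_continuous (fourier (-m))).smul (continuous_const.mul ?_)
    refine (continuous_subtype_val.comp AddCircle.continuous_toCircle).zpow₀ n fun t => ?_
    exact Or.inl (Circle.coe_ne_zero _)
  have h2 := hasSum_integral_of_summable_integral_norm (μ := AddCircle.haarAddCircle)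
    (F := fun n (t : AddCircle (2 * π)) => fourier (-m) t • (c n * ((t.toCircle : Circle) : ℂ) ^ n))
    (fun n => (h1 n).integrable_of_hasCompactSupport (HasCompactSupport.of_compactSpace _)) (by
      refine hc.congr fun n => ?_
      simp only [norm_smul, norm_mul, norm_circle_zpow, fourier_apply, Circle.norm_coe, one_mul,
        mul_one]
      simp)
  have h3 : ∀ t : AddCircle (2 * π),
      ∑' n, fourier (-m) t • (c n * ((t.toCircle : Circle) : ℂ) ^ n) =
        fourier (-m) t • f t.toCircle := fun t => ((hf _).const_smul _).tsum_eq
  simp only [h3] at h2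
  have h4 : ∀ n, ∫ t : AddCircle (2 * π),
      fourier (-m) t • (c n * ((t.toCircle : Circle) : ℂ) ^ n) ∂AddCircle.haarAddCircle =
        if n = m then c m else 0 := fun n => by
    have := coeff_zpow n m
    rw [coeff, fourierCoeff] at this
    simp only [smul_eq_mul, mul_left_comm _ (c n)]  at this ⊢
    rw [integral_const_mul, this]
    by_cases hnm : n = m
    · simp [hnm]
    · simp [hnm, Ne.symm hnm]
  simp only [h4] at h2
  exact h2.unique (hasSum_ite_eq m (c m))

/-- A rapidly decreasing sequence is the sequence of Fourier coefficients of a smooth function. -/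
theorem exists_smooth_of_summable {c : ℤ → ℂ}
    (hc : ∀ k : ℕ, Summable fun n : ℤ => ‖c n‖ * (1 + |(n : ℝ)|) ^ k) :
    ∃ f : Smooth, ∀ n, coeff f n = c n := by
  have hc0 : Summable fun n => ‖c n‖ := by simpa using hc 0
  have hs : ContDiff ℝ ∞ (fun t : ℝ => ∑' n : ℤ, c n * Complex.exp ((n * Complex.I) * t)) := by
    refine contDiff_tsum (v := fun k n => ‖c n‖ * (1 + |(n : ℝ)|) ^ k) (fun n => ?_)
      (fun k _ => hc k) (fun k n t _ => ?_)
    · have h0 : ContDiff ℝ ∞ (fun t : ℝ => (t : ℂ)) := Complex.ofRealCLM.contDiff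
      fun_prop
    · rw [norm_iteratedFDeriv_eq_norm_iteratedDeriv]
      have : iteratedDeriv k (fun t : ℝ => c n * Complex.exp ((n * Complex.I) * t)) =
          fun t : ℝ => c n * ((n * Complex.I) ^ k * Complex.exp ((n * Complex.I) * t)) := by
        clear * -
        induction k with
        | zero => simp
        | succ k ih =>
          rw [iteratedDeriv_succ, ih]
          funext t
          have h1 : HasDerivAt (fun t : ℝ => Complex.exp ((n * Complex.I) * t))
              (Complex.exp ((n * Complex.I) * t) * ((n * Complex.I) * 1)) t :=
            ((Complex.ofRealCLM.hasDerivAt (x := t)).const_mul (n * Complex.I)).cexp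
          rw [((h1.const_mul _).const_mul _).deriv]
          ring
      rw [this]
      have h2 : ‖Complex.exp ((n * Complex.I) * t)‖ = 1 := by
        rw [Complex.norm_exp]; simp
      rw [norm_mul, norm_mul, h2, norm_pow, norm_mul, Complex.norm_I, Complex.norm_intCast]
      rw [mul_one, mul_one]
      gcongr
      linarith [abs_nonneg (n : ℝ)]
  have hz : ∀ z : Circle, Summable fun n : ℤ => c n * (z : ℂ) ^ n := fun z =>
    Summable.of_norm (by simpa only [norm_mul, norm_circle_zpow, mul_one] using hc0)
  refine ⟨⟨fun z => ∑' n : ℤ, c n * (z : ℂ) ^ n, (contMDiff_iff_contDiff_exp _).2 ?_⟩, fun n =>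
    coeff_of_hasSum hc0 (fun z => (hz z).hasSum) n⟩
  convert hs using 4 with t n
  rw [Circle.coe_exp, ← Complex.exp_int_mul]
  congr 1
  ring_nf

/-- A smooth function on the circle belongs to `a^∞` iff its negative Fourier coefficients
vanish. -/
theorem mem_aInf_iff {f : Smooth} : f ∈ aInf ↔ ∀ n < 0, coeff f n = 0 := by
  constructor
  · rintro ⟨F, hF, hf⟩ n hn
    -- The coefficient of index -(m + 1) is, up to a nonzero factor, the contour integral of z^m
    -- F(z), which vanishes by Cauchy's theorem; dz = i z dt supplies the extra power of z.
    obtain ⟨m, rfl⟩ : ∃ m : ℕ, n = -(m + 1 : ℤ) := ⟨(-n - 1).toNat, by omega⟩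
    have h1 : DiffContOnCl ℂ (fun z => z ^ m • F z) (Metric.ball 0 1) :=
      DiffContOnCl.smul ((differentiable_id.pow m).diffContOnCl) hF
    have h2 := h1.circleIntegral_eq_zero zero_le_one
    rw [circleIntegral] at h2
    rw [coeff_eq_integral]
    have h3 : ∫ t in (0 : ℝ)..(2 * π), deriv (circleMap 0 1) t •
          (fun z => z ^ m • F z) (circleMap 0 1 t) =
        Complex.I * ∫ t in (0 : ℝ)..(2 * π),
          Complex.exp (-(((-(m + 1 : ℤ) : ℤ) : ℂ) * t * Complex.I)) * f (Circle.exp t) := by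
      rw [← intervalIntegral.integral_const_mul]
      refine intervalIntegral.integral_congr fun t _ => ?_
      have h4 : circleMap 0 1 t = (Circle.exp t : ℂ) := by simp [circleMap]
      simp only [deriv_circleMap, h4, hf, smul_eq_mul]
      have h5 : Complex.exp (-(((-(m + 1 : ℤ) : ℤ) : ℂ) * t * Complex.I)) =
          (Circle.exp t : ℂ) ^ (m + 1) := by
        rw [Circle.coe_exp, ← Complex.exp_nat_mul]
        congr 1
        push_cast
        ring
      rw [h5, pow_succ]
      ring
    rw [h3, mul_eq_zero] at h2
    rw [h2.resolve_left Complex.I_ne_zero, smul_zero]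
  · intro h
    have hs : Summable fun n : ℕ => ‖coeff f n‖ :=
      (summable_norm_coeff f).comp_injective Nat.cast_injective
    have hb : ∀ (n : ℕ) (z : ℂ), ‖z‖ ≤ 1 → ‖coeff f n * z ^ n‖ ≤ ‖coeff f n‖ := fun n z hz => by
      rw [norm_mul, norm_pow]
      exact mul_le_of_le_one_right (norm_nonneg _) (pow_le_one₀ (norm_nonneg _) hz)
    refine ⟨fun z => ∑' n : ℕ, coeff f n * z ^ n, ⟨?_, ?_⟩, fun z => ?_⟩
    · refine Complex.differentiableOn_tsum_of_summable_norm hs (fun n => ?_) Metric.isOpen_ball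
        fun n z hz => hb n z (by simpa using (mem_ball_zero_iff.1 hz).le)
      exact ((differentiable_id.pow n).const_mul _).differentiableOn
    · rw [closure_ball _ one_ne_zero]
      refine continuousOn_tsum (fun n => ?_) hs fun n z hz => hb n z (mem_closedBall_zero_iff.1 hz)
      exact (continuous_const.mul (continuous_id.pow n)).continuousOn
    · have h1 := hasSum_coeff_mul_zpow f z
      have h2 : HasSum (fun n : ℕ => coeff f n * (z : ℂ) ^ n) (f z) := by
        have := (Nat.cast_injective (R := ℤ)).hasSum_iff (f := fun n : ℤ => coeff f n * (z : ℂ) ^ n)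
          (a := f z) (fun n hn => ?_)
        · simpa [Function.comp_def] using this.2 h1
        · rw [h n, zero_mul]
          by_contra hn'
          exact hn ⟨n.toNat, by simpa using not_lt.1 hn'⟩
      exact h2.tsum_eq

theorem alphaPow_mem_aInf {k : ℤ} (hk : 0 ≤ k) : alphaPow k ∈ aInf :=
  mem_aInf_iff.2 fun n hn => by rw [coeff_alphaPow, if_neg (by omega)]

/-! ### The Fréchet topology of `C^∞(𝕋)` -/

instance : IsTopologicalAddGroup Smooth := withSeminorms_rho.topologicalAddGroup

instance : ContinuousSMul ℂ Smooth := withSeminorms_rho.continuousSMul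

instance : ContinuousSMul ℝ Smooth := IsScalarTower.continuousSMul ℂ

instance : LocallyConvexSpace ℝ Smooth := withSeminorms_rho.toLocallyConvexSpace

theorem rho_apply (ν : ℝ≥0) (f : Smooth) :
    rho ν f = ∑' n : ℤ, ‖coeff f n‖ * (1 + |(n : ℝ)|) ^ (ν : ℝ) := rfl

theorem continuous_rho (ν : ℝ≥0) : Continuous (rho ν) := withSeminorms_rho.continuous_seminorm ν

theorem coeff_zero (n : ℤ) : coeff (0 : Smooth) n = 0 := by
  simpa using coeff_smul 0 (0 : Smooth) n

theorem coeff_sub (f g : Smooth) (n : ℤ) :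
    coeff (f - g : Smooth) n = coeff f n - coeff g n := by
  rw [eq_sub_iff_add_eq, ← coeff_add, sub_add_cancel]

theorem weight_nonneg (a : ℝ) (n : ℤ) (ν : ℝ) (ha : 0 ≤ a) :
    0 ≤ a * (1 + |(n : ℝ)|) ^ ν := by positivity

theorem rho_mono {ν μ : ℝ≥0} (h : ν ≤ μ) (f : Smooth) : rho ν f ≤ rho μ f :=
  (summable_rho ν f).tsum_le_tsum (fun n => by
    gcongr
    exact one_le_one_add_abs n) (summable_rho μ f)

theorem norm_coeff_mul_le_rho (ν : ℝ≥0) (f : Smooth) (n : ℤ) :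
    ‖coeff f n‖ * (1 + |(n : ℝ)|) ^ (ν : ℝ) ≤ rho ν f :=
  (summable_rho ν f).le_tsum n fun _ _ => weight_nonneg _ _ _ (norm_nonneg _)

theorem norm_coeff_le_rho (ν : ℝ≥0) (f : Smooth) (n : ℤ) : ‖coeff f n‖ ≤ rho ν f :=
  (le_mul_of_one_le_right (norm_nonneg _)
    (Real.one_le_rpow (one_le_one_add_abs n) ν.2)).trans (norm_coeff_mul_le_rho ν f n)

theorem rho_alphaPow (ν : ℝ≥0) (n : ℤ) : rho ν (alphaPow n) = (1 + |(n : ℝ)|) ^ (ν : ℝ) := by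
  rw [rho_apply, tsum_eq_single n (fun m hm => by rw [coeff_alphaPow, if_neg hm]; simp)]
  simp [coeff_alphaPow]

theorem rho_eq_zero {ν : ℝ≥0} {f : Smooth} (h : rho ν f = 0) : f = 0 :=
  Smooth.ext_coeff fun n => by
    rw [coeff_zero]
    exact norm_le_zero_iff.1 (h ▸ norm_coeff_le_rho ν f n)

theorem norm_apply_le_rho (f : Smooth) (z : Circle) : ‖f z‖ ≤ rho 0 f := by
  have h := summable_norm_coeff f
  rw [← (hasSum_coeff_mul_zpow f z).tsum_eq, rho_apply]
  refine (norm_tsum_le_tsum_norm ?_).trans_eq (tsum_congr fun n => ?_)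
  · simpa only [norm_mul, norm_circle_zpow, mul_one] using h
  · simp only [norm_mul, norm_circle_zpow]; simp

/-- Differentiation in z shifts the index by one and multiplies by it; the shift costs the factor
2^ν because 1 + |n| ≤ 2 (1 + |n + 1|). -/
theorem rho_D_le (ν : ℝ≥0) (f : Smooth) : rho ν (D f) ≤ 2 ^ (ν : ℝ) * rho (ν + 1) f := by
  have h1 := (Equiv.addRight (1 : ℤ)).summable_iff.2 (summable_rho (ν + 1) f)
  have h2 : rho (ν + 1) f =
      ∑' n : ℤ, ‖coeff f (n + 1)‖ * (1 + |((n + 1 : ℤ) : ℝ)|) ^ ((ν + 1 : ℝ≥0) : ℝ) :=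
    ((Equiv.addRight (1 : ℤ)).tsum_eq
      fun n : ℤ => ‖coeff f n‖ * (1 + |(n : ℝ)|) ^ ((ν + 1 : ℝ≥0) : ℝ)).symm
  rw [h2, ← tsum_mul_left, rho_apply]
  refine (summable_rho ν (D f)).tsum_le_tsum (fun n => ?_) (h1.mul_left _)
  rw [coeff_D, norm_mul]
  have h3 : ‖(n + 1 : ℂ)‖ ≤ 1 + |((n + 1 : ℤ) : ℝ)| := by
    have : (n + 1 : ℂ) = ((n + 1 : ℤ) : ℂ) := by push_cast; rfl
    rw [this, Complex.norm_intCast]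
    linarith
  have h4 : (1 + |(n : ℝ)|) ≤ 2 * (1 + |((n + 1 : ℤ) : ℝ)|) := by
    have := abs_sub ((n : ℝ) + 1) 1
    rw [add_sub_cancel_right, abs_one] at this
    push_cast
    linarith [abs_nonneg ((n : ℝ) + 1)]
  have h5 : (1 + |(n : ℝ)|) ^ (ν : ℝ) ≤ 2 ^ (ν : ℝ) * (1 + |((n + 1 : ℤ) : ℝ)|) ^ (ν : ℝ) := by
    rw [← Real.mul_rpow (by norm_num) (by positivity)]
    gcongr
  rw [NNReal.coe_add, NNReal.coe_one, Real.rpow_add (by positivity), Real.rpow_one]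
  calc ‖(n + 1 : ℂ)‖ * ‖coeff f (n + 1)‖ * (1 + |(n : ℝ)|) ^ (ν : ℝ)
      ≤ (1 + |((n + 1 : ℤ) : ℝ)|) * ‖coeff f (n + 1)‖ *
        (2 ^ (ν : ℝ) * (1 + |((n + 1 : ℤ) : ℝ)|) ^ (ν : ℝ)) := by gcongr
    _ = _ := by ring

theorem tendsto_iff_rho {ι : Type*} {l : Filter ι} {u : ι → Smooth} {f : Smooth} :
    Tendsto u l (𝓝 f) ↔ ∀ ν : ℝ≥0, Tendsto (fun i => rho ν (u i - f)) l (𝓝 0) := by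
  rw [withSeminorms_rho.tendsto_nhds]
  refine forall_congr' fun ν => ?_
  rw [Metric.tendsto_nhds]
  simp only [dist_zero_right, Real.norm_of_nonneg (apply_nonneg (rho ν) _)]

/-- Integer orders suffice because the norms increase with ν. A countable family gives first
countability, hence a countably generated uniformity, as Baire's theorem requires. -/
theorem withSeminorms_rho_nat : WithSeminorms fun k : ℕ => rho (k : ℝ≥0) := by
  refine withSeminorms_rho.congr (fun k => ⟨{(k : ℝ≥0)}, 1, fun f => ?_⟩)
    (fun ν => ⟨{⌈ν⌉₊}, 1, fun f => ?_⟩)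
  · simp
  · simpa using rho_mono (Nat.le_ceil ν) f

instance : FirstCountableTopology Smooth := withSeminorms_rho_nat.firstCountableTopology

instance : T1Space Smooth := withSeminorms_rho.T1_of_separating fun _ hf => ⟨0, fun h => hf (rho_eq_zero h)⟩

/-! ### Completeness of C^∞(𝕋) and convergence of series -/

noncomputable instance : UniformSpace Smooth := IsTopologicalAddGroup.rightUniformSpace Smooth

instance : IsUniformAddGroup Smooth := isUniformAddGroup_of_addCommGroup

instance : (uniformity Smooth).IsCountablyGenerated :=
  IsUniformAddGroup.uniformity_countably_generated

theorem exists_tendsto_of_cauchy {u : ℕ → Smooth}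
    (hu : ∀ ν : ℝ≥0, ∀ ε > 0, ∃ N, ∀ m ≥ N, ∀ n ≥ N, rho ν (u m - u n) ≤ ε) :
    ∃ f, Tendsto u atTop (𝓝 f) := by
  have hc : ∀ j : ℤ, ∃ c : ℂ, Tendsto (fun n => coeff (u n) j) atTop (𝓝 c) := fun j => by
    refine cauchySeq_tendsto_of_complete (Metric.cauchySeq_iff.2 fun ε hε => ?_)
    obtain ⟨N, hN⟩ := hu 0 (ε / 2) (half_pos hε)
    refine ⟨N, fun m hm n hn => ?_⟩
    rw [dist_eq_norm, ← coeff_sub]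
    exact ((norm_coeff_le_rho 0 _ j).trans (hN m hm n hn)).trans_lt (half_lt_self hε)
  choose c hc using hc
  -- The limit of coefficients is only pointwise, so the Cauchy bound is passed to the limit on
  -- finite sets of indices; uniformity in S then recovers the full norm.
  have hsum : ∀ ν : ℝ≥0, ∀ ε > 0, ∃ N, ∀ m ≥ N, ∀ S : Finset ℤ,
      ∑ j ∈ S, ‖coeff (u m) j - c j‖ * (1 + |(j : ℝ)|) ^ (ν : ℝ) ≤ ε := fun ν ε hε => by
    obtain ⟨N, hN⟩ := hu ν ε hε
    refine ⟨N, fun m hm S => ?_⟩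
    have h1 : Tendsto (fun n => ∑ j ∈ S, ‖coeff (u m) j - coeff (u n) j‖ *
        (1 + |(j : ℝ)|) ^ (ν : ℝ)) atTop
        (𝓝 (∑ j ∈ S, ‖coeff (u m) j - c j‖ * (1 + |(j : ℝ)|) ^ (ν : ℝ))) :=
      tendsto_finsetSum _ fun j _ => ((tendsto_const_nhds.sub (hc j)).norm).mul_const _
    refine le_of_tendsto h1 ((eventually_ge_atTop N).mono fun n hn => ?_)
    simp only [← coeff_sub]
    exact ((summable_rho ν _).sum_le_tsum S fun _ _ => weight_nonneg _ _ _ (norm_nonneg _)).trans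
      (hN m hm n hn)
  have hsm : ∀ ν : ℝ≥0, Summable fun j : ℤ => ‖c j‖ * (1 + |(j : ℝ)|) ^ (ν : ℝ) := fun ν => by
    obtain ⟨N, hN⟩ := hsum ν 1 one_pos
    have h1 := (summable_of_sum_le (fun j => weight_nonneg _ _ _ (norm_nonneg _))
      (hN N le_rfl)).add (summable_rho ν (u N))
    refine Summable.of_nonneg_of_le (fun j => weight_nonneg _ _ _ (norm_nonneg _)) (fun j => ?_) h1
    rw [← add_mul]
    gcongr
    have := norm_sub_le (coeff (u N) j) (coeff (u N) j - c j)
    rw [sub_sub_cancel] at this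
    linarith
  obtain ⟨f, hf⟩ := exists_smooth_of_summable (c := c) fun k => by simpa using hsm k
  refine ⟨f, tendsto_iff_rho.2 fun ν => Metric.tendsto_atTop.2 fun ε hε => ?_⟩
  obtain ⟨N, hN⟩ := hsum ν (ε / 2) (half_pos hε)
  refine ⟨N, fun m hm => ?_⟩
  rw [dist_zero_right, Real.norm_of_nonneg (apply_nonneg _ _)]
  refine lt_of_le_of_lt ?_ (half_lt_self hε)
  refine (summable_rho ν _).tsum_le_of_sum_le fun S => ?_
  simpa only [coeff_sub, hf] using hN m hm S

instance : CompleteSpace Smooth := by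
  refine UniformSpace.complete_of_cauchySeq_tendsto fun u hu => exists_tendsto_of_cauchy ?_
  intro ν ε hε
  have h : Tendsto (fun p : ℕ × ℕ => u p.2 - u p.1) atTop (𝓝 0) := by
    have := cauchySeq_iff_tendsto.1 hu
    rw [uniformity_eq_comap_nhds_zero, tendsto_comap_iff] at this
    exact this
  have h2 := ((continuous_rho ν).tendsto 0).comp h
  rw [map_zero] at h2
  have h3 := (h2.eventually (eventually_le_nhds hε))
  rw [eventually_atTop] at h3
  obtain ⟨⟨a, b⟩, hab⟩ := h3
  exact ⟨max a b, fun m hm n hn => hab (n, m)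
    ⟨(le_max_left a b).trans hn, (le_max_right a b).trans hm⟩⟩

theorem summable_of_summable_rho {a : ℕ → Smooth} (ha : ∀ k : ℕ, Summable fun n => rho k (a n)) :
    ∃ f, Tendsto (fun n => ∑ i ∈ Finset.range n, a i) atTop (𝓝 f) := by
  refine exists_tendsto_of_cauchy fun ν ε hε => ?_
  have h1 : Summable fun n => rho ν (a n) :=
    Summable.of_nonneg_of_le (fun n => apply_nonneg _ _)
      (fun n => rho_mono (Nat.le_ceil ν) (a n)) (ha ⌈ν⌉₊)
  have h2 := h1.hasSum.tendsto_sum_nat.cauchySeq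
  obtain ⟨N, hN⟩ := Metric.cauchySeq_iff.1 h2 ε hε
  have key : ∀ n m, n ≤ m → rho ν (∑ i ∈ Finset.range m, a i - ∑ i ∈ Finset.range n, a i) ≤
      ∑ i ∈ Finset.range m, rho ν (a i) - ∑ i ∈ Finset.range n, rho ν (a i) := fun n m hnm => by
    rw [← Finset.sum_Ico_eq_sub _ hnm, ← Finset.sum_Ico_eq_sub _ hnm]
    exact Finset.le_sum_of_subadditive (rho ν) (map_zero _).le (map_add_le_add _) _ _
  refine ⟨N, fun m hm n hn => ?_⟩
  have h3 := (hN m hm n hn).le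
  rw [Real.dist_eq] at h3
  rcases le_total n m with h | h
  · exact ((key n m h).trans (le_abs_self _)).trans h3
  · rw [map_sub_rev]
    rw [abs_sub_comm] at h3
    exact ((key m n h).trans (le_abs_self _)).trans h3

/-- The Fourier series of a smooth function converges in `C^∞(𝕋)`. -/
theorem hasSum_coeff_smul_alphaPow (f : Smooth) :
    HasSum (fun n : ℤ => coeff f n • alphaPow n) f := by
  have hco : ∀ (S : Finset ℤ) (m : ℤ), coeff (∑ n ∈ S, coeff f n • alphaPow n : Smooth) m =
      if m ∈ S then coeff f m else 0 := fun S m => by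
    induction S using Finset.induction_on with
    | empty => simp [coeff_zero]
    | insert a S ha ih =>
      rw [Finset.sum_insert ha, coeff_add, ih, coeff_smul, coeff_alphaPow]
      by_cases h : m = a
      · subst h; simp [ha]
      · simp [h]
  refine tendsto_iff_rho.2 fun ν => ?_
  have h1 := (tendsto_const_nhds (x := rho ν f)).sub (summable_rho ν f).hasSum
  rw [← rho_apply, sub_self] at h1
  refine h1.congr fun S => ?_
  rw [sub_eq_iff_eq_add, map_sub_rev]
  -- The remainder has the coefficients of f outside S and zero inside, so its norm is the tail of
  -- the series defining ρ_ν(f).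
  have h2 : ∀ n : ℤ, ‖coeff (f - ∑ n ∈ S, coeff f n • alphaPow n : Smooth) n‖ *
      (1 + |(n : ℝ)|) ^ (ν : ℝ) = (if n ∈ S then 0 else ‖coeff f n‖ *
      (1 + |(n : ℝ)|) ^ (ν : ℝ)) := fun n => by
    rw [coeff_sub, hco]
    split_ifs <;> simp
  rw [rho_apply, rho_apply, ← (summable_rho ν f).sum_add_tsum_compl (s := S), add_comm]
  congr 1
  simp only [h2]
  refine (tsum_subtype ((S : Set ℤ)ᶜ) fun n : ℤ =>
    ‖coeff f n‖ * (1 + |(n : ℝ)|) ^ (ν : ℝ)).trans (tsum_congr fun n => ?_)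
  by_cases h : n ∈ S <;> simp [h, Set.indicator]

/-! ### Distributions -/

theorem hasSum_coeff_mul_distribution (T : Distribution) (f : Smooth) :
    HasSum (fun n : ℤ => coeff f n * T (alphaPow n)) (T f) := by
  simpa using T.hasSum (hasSum_coeff_smul_alphaPow f)

theorem distribution_ext {S T : Distribution} (h : ∀ n, S (alphaPow n) = T (alphaPow n)) : S = T :=
  ContinuousLinearMap.ext fun f => (hasSum_coeff_mul_distribution S f).unique <| by
    simpa only [h] using hasSum_coeff_mul_distribution T f

/-- Continuity bounds T by finitely many norms; as they increase with ν, one of them suffices. This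
is the finite order of a distribution. -/
theorem exists_norm_distribution_le (T : Distribution) :
    ∃ C > 0, ∃ ν : ℝ≥0, ∀ f, ‖T f‖ ≤ C * rho ν f := by
  obtain ⟨S, C, hC, h⟩ := Seminorm.bound_of_continuous withSeminorms_rho
    ((normSeminorm ℂ ℂ).comp T.toLinearMap) (T.continuous.norm)
  obtain ⟨ν, hν⟩ : ∃ ν, ∀ μ ∈ S, μ ≤ ν := ⟨S.sup id, fun μ hμ => Finset.le_sup (f := id) hμ⟩
  refine ⟨C, by positivity, ν, fun f => (h f).trans ?_⟩
  change C • S.sup rho f ≤ C * rho ν f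
  rw [NNReal.smul_def, smul_eq_mul]
  gcongr
  exact Seminorm.finset_sup_apply_le (apply_nonneg _ _) fun μ hμ => rho_mono (hν μ hμ) f

theorem norm_distribution_le {T : Distribution} {ν : ℝ≥0} {C : ℝ}
    (h : ∀ n : ℤ, ‖T (alphaPow n)‖ ≤ C * (1 + |(n : ℝ)|) ^ (ν : ℝ)) (f : Smooth) :
    ‖T f‖ ≤ C * rho ν f := by
  have h1 : ∀ n : ℤ, ‖coeff f n * T (alphaPow n)‖ ≤
      C * (‖coeff f n‖ * (1 + |(n : ℝ)|) ^ (ν : ℝ)) := fun n => by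
    rw [norm_mul]
    calc _ ≤ ‖coeff f n‖ * (C * (1 + |(n : ℝ)|) ^ (ν : ℝ)) := by gcongr; exact h n
      _ = _ := by ring
  rw [← (hasSum_coeff_mul_distribution T f).tsum_eq, rho_apply, ← tsum_mul_left]
  exact tsum_of_norm_bounded ((summable_rho ν f).mul_left C).hasSum h1

/-- A linear functional bounded by one of the norms, as a distribution. -/
noncomputable def mkDistribution (T : Smooth →ₗ[ℂ] ℂ) (ν : ℝ≥0) (C : ℝ)
    (h : ∀ f, ‖T f‖ ≤ C * rho ν f) : Distribution where
  toLinearMap := T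
  cont := by
    refine withSeminorms_rho.continuous_of_isBounded (norm_withSeminorms ℂ ℂ) T
      fun _ => ⟨{ν}, C.toNNReal, fun f => ?_⟩
    simp only [Finset.sup_singleton]
    change ‖T f‖ ≤ C.toNNReal • rho ν f
    rw [NNReal.smul_def, smul_eq_mul]
    exact (h f).trans (mul_le_mul_of_nonneg_right (Real.le_coe_toNNReal C) (apply_nonneg _ _))

/-- A sequence of polynomial growth gives a distribution. -/
theorem exists_distribution {b : ℤ → ℂ} {C : ℝ} {ν : ℝ≥0}
    (hb : ∀ n : ℤ, ‖b n‖ ≤ C * (1 + |(n : ℝ)|) ^ (ν : ℝ)) :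
    ∃ T : Distribution, ∀ n, T (alphaPow n) = b n := by
  have h1 : ∀ (f : Smooth) (n : ℤ), ‖coeff f n * b n‖ ≤
      C * (‖coeff f n‖ * (1 + |(n : ℝ)|) ^ (ν : ℝ)) := fun f n => by
    rw [norm_mul]
    calc _ ≤ ‖coeff f n‖ * (C * (1 + |(n : ℝ)|) ^ (ν : ℝ)) := by gcongr; exact hb n
      _ = _ := by ring
  have hs : ∀ f : Smooth, Summable fun n => coeff f n * b n := fun f =>
    Summable.of_norm_bounded ((summable_rho ν f).mul_left C) (h1 f)
  let L : Smooth →ₗ[ℂ] ℂ :=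
    { toFun := fun f => ∑' n, coeff f n * b n
      map_add' := fun f g => by
        rw [← (hs f).tsum_add (hs g)]
        simp only [coeff_add, add_mul]
      map_smul' := fun c f => by
        rw [RingHom.id_apply, smul_eq_mul, ← tsum_mul_left]
        simp only [coeff_smul, mul_assoc] }
  refine ⟨mkDistribution L ν C fun f => ?_, fun n => ?_⟩
  · change ‖∑' n, coeff f n * b n‖ ≤ _
    rw [rho_apply, ← tsum_mul_left]
    exact tsum_of_norm_bounded ((summable_rho ν f).mul_left C).hasSum (h1 f)
  · change ∑' m, coeff (alphaPow n) m * b m = b n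
    rw [tsum_eq_single n fun m hm => by rw [coeff_alphaPow, if_neg hm, zero_mul]]
    rw [coeff_alphaPow, if_pos rfl, one_mul]

/-! ### Closedness of the subspaces -/

theorem exists_rho_D_pow_le (i : ℕ) : ∃ (ν : ℝ≥0) (C : ℝ), ∀ f, rho 0 ((D ^ i) f) ≤ C * rho ν f := by
  suffices ∀ μ : ℝ≥0, ∃ (ν : ℝ≥0) (C : ℝ), ∀ f, rho μ ((D ^ i) f) ≤ C * rho ν f from this 0
  induction i with
  | zero => exact fun μ => ⟨μ, 1, fun f => by simp⟩
  | succ i ih =>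
    intro μ
    obtain ⟨ν, C, h⟩ := ih (μ + 1)
    refine ⟨ν, 2 ^ (μ : ℝ) * C, fun f => ?_⟩
    rw [pow_succ', Module.End.mul_apply]
    refine (rho_D_le μ _).trans ?_
    rw [mul_assoc]
    gcongr
    exact h f

/-- The distribution `f ↦ f^{(i)}(z)`. -/
theorem exists_distribution_deriv (i : ℕ) (z : Circle) :
    ∃ T : Distribution, ∀ f, T f = (D ^ i) f z := by
  obtain ⟨ν, C, h⟩ := exists_rho_D_pow_le i
  exact ⟨mkDistribution
    { toFun := fun f => (D ^ i) f z
      map_add' := fun f g => by rw [map_add, Smooth.add_apply]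
      map_smul' := fun c f => by rw [map_smul, Smooth.smul_apply]; rfl } ν C
    fun f => (norm_apply_le_rho _ z).trans (h f), fun f => rfl⟩

theorem isClosed_idealInf (E : Set Circle) : IsClosed (idealInf E : Set Smooth) := by
  have : (idealInf E : Set Smooth) = ⋂ (i : ℕ) (z ∈ E), {f | (D ^ i) f z = 0} := by
    ext f; simp [idealInf]
  rw [this]
  refine isClosed_iInter fun i => isClosed_biInter fun z _ => ?_
  obtain ⟨T, hT⟩ := exists_distribution_deriv i z
  simp only [← hT]
  exact isClosed_eq T.continuous continuous_const

theorem exists_distribution_coeff (n : ℤ) : ∃ T : Distribution, ∀ f, T f = coeff f n :=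
  ⟨mkDistribution
    { toFun := fun f => coeff f n
      map_add' := fun f g => coeff_add f g n
      map_smul' := fun c f => coeff_smul c f n } 0 1
    fun f => by rw [one_mul]; exact norm_coeff_le_rho 0 f n, fun _ => rfl⟩

theorem isClosed_aInf : IsClosed (aInf : Set Smooth) := by
  have : (aInf : Set Smooth) = ⋂ (n : ℤ) (_ : n < 0), {f : Smooth | coeff f n = 0} := by
    ext f; simp [mem_aInf_iff]
  rw [this]
  refine isClosed_iInter fun n => isClosed_iInter fun _ => ?_
  obtain ⟨T, hT⟩ := exists_distribution_coeff n
  simp only [← hT]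
  exact isClosed_eq T.continuous continuous_const

/-- A distribution vanishes on `a^∞` iff its Fourier coefficients of index `≤ 0` vanish. -/
theorem mem_annihilator_aInf_iff {T : Distribution} :
    T ∈ annihilator aInf ↔ ∀ n : ℤ, 0 ≤ n → T (alphaPow n) = 0 := by
  refine ⟨fun h n hn => h _ (alphaPow_mem_aInf hn), fun h f hf => ?_⟩
  refine (hasSum_coeff_mul_distribution T f).unique (hasSum_zero.congr_fun fun n => ?_)
  rcases lt_or_ge n 0 with hn | hn
  · rw [mem_aInf_iff.1 hf n hn, zero_mul]
  · rw [h n hn, mul_zero]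

/-! ### The open mapping argument -/

theorem exists_rho_sub_le_of_mem_closure {V : Set Smooth} {f : Smooth} (hf : f ∈ closure V)
    (ν : ℝ≥0) {ε : ℝ} (hε : 0 < ε) : ∃ g ∈ V, rho ν (f - g) ≤ ε := by
  have ho : IsOpen {g | rho ν (f - g) < ε} :=
    isOpen_lt ((continuous_rho ν).comp (continuous_const.sub continuous_id)) continuous_const
  obtain ⟨g, hg, hgV⟩ := mem_closure_iff.1 hf _ ho (by simpa using hε)
  exact ⟨g, hgV, le_of_lt hg⟩

/-- Approximate decompositions with a bound on the first component can be made exact. -/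
theorem exists_decomposition_of_approximate {A I : Submodule ℂ Smooth}
    (hA : IsClosed (A : Set Smooth)) (hI : IsClosed (I : Set Smooth))
    (h : ∀ s : ℕ, ∃ t : ℝ≥0, ∃ C > 0, ∀ f, ∀ r : ℝ≥0, ∀ ε > 0,
      ∃ a ∈ A, ∃ i ∈ I, rho s a ≤ C * rho t f ∧ rho r (f - a - i) ≤ ε) (s : ℝ≥0) :
    ∃ t : ℝ≥0, ∃ C > 0, ∀ f, ∃ a ∈ A, f - a ∈ I ∧ rho s a ≤ C * rho t f := by
  -- The k-th correction is controlled in order ⌈s⌉ + k, so that the sum of the corrections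
  -- converges in every norm.
  choose t C hC h using fun k : ℕ => h (⌈s⌉₊ + k)
  refine ⟨t 0, 2 * (C 0 + 1), by have := hC 0; positivity, fun f => ?_⟩
  by_cases hf : f = 0
  · exact ⟨0, A.zero_mem, by simp [hf], by simp [hf]⟩
  set R := rho (t 0) f with hRdef
  have hR : 0 < R := (apply_nonneg _ _).lt_of_ne' fun h0 => hf (rho_eq_zero h0)
  -- The error g' is made small in two norms: in order t (k + 1), weighted by C (k + 1), to bound
  -- the next correction, and in order k, to force the errors to 0 in C^∞(𝕋).
  have step : ∀ (k : ℕ) (g : Smooth), ∃ a g' : Smooth, a ∈ A ∧ g - a - g' ∈ I ∧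
      rho (⌈s⌉₊ + k : ℕ) a ≤ C k * rho (t k) g ∧
      C (k + 1) * rho (t (k + 1)) g' ≤ R * (1 / 2) ^ (k + 1) ∧ rho k g' ≤ R * (1 / 2) ^ (k + 1) := by
    intro k g
    have hC' := hC (k + 1)
    obtain ⟨a, ha, i, hi, h1, h2⟩ := h k g (max (t (k + 1)) k)
      (min (R * (1 / 2) ^ (k + 1) / C (k + 1)) (R * (1 / 2) ^ (k + 1))) (by positivity)
    refine ⟨a, g - a - i, ha, by simpa using hi, h1, ?_, ?_⟩
    · rw [mul_comm, ← le_div_iff₀ hC']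
      exact (rho_mono (le_max_left _ _) _).trans (h2.trans (min_le_left _ _))
    · exact (rho_mono (le_max_right _ _) _).trans (h2.trans (min_le_right _ _))
  choose a next ha hnext h1 h2 h3 using step
  let g : ℕ → Smooth := fun n => Nat.rec f (fun k x => next k x) n
  have hg0 : g 0 = f := rfl
  have hg : ∀ k, g (k + 1) = next k (g k) := fun k => rfl
  have hb : ∀ k, rho (⌈s⌉₊ + k : ℕ) (a k (g k)) ≤ (C 0 + 1) * R * (1 / 2) ^ k := by
    intro k
    have hC0 := hC 0
    refine (h1 k (g k)).trans ?_
    cases k with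
    | zero => rw [hg0, ← hRdef, pow_zero, mul_one]; gcongr; linarith
    | succ k =>
      rw [hg]
      refine (h2 k (g k)).trans ?_
      gcongr
      exact le_mul_of_one_le_left hR.le (by linarith)
  have hgeo : Summable fun k : ℕ => (C 0 + 1) * R * (1 / 2 : ℝ) ^ k :=
    summable_geometric_two.mul_left _
  obtain ⟨x, hx⟩ := summable_of_summable_rho (a := fun k => a k (g k)) fun j => by
    refine Summable.of_norm_bounded_eventually_nat hgeo ?_
    filter_upwards [eventually_ge_atTop j] with k hk
    rw [Real.norm_of_nonneg (apply_nonneg _ _)]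
    exact (rho_mono (by exact_mod_cast hk.trans (Nat.le_add_left _ _)) _).trans (hb k)
  have hgt : Tendsto g atTop (𝓝 0) := by
    refine tendsto_iff_rho.2 fun ν => ?_
    simp only [sub_zero]
    have hz : Tendsto (fun k : ℕ => R * (1 / 2 : ℝ) ^ k) atTop (𝓝 0) := by
      simpa using (tendsto_pow_atTop_nhds_zero_of_lt_one (r := (1 / 2 : ℝ)) (by norm_num)
        (by norm_num)).const_mul R
    refine tendsto_of_tendsto_of_tendsto_of_le_of_le' tendsto_const_nhds hz
      (Eventually.of_forall fun k => apply_nonneg _ _) ?_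
    filter_upwards [eventually_ge_atTop (⌈ν⌉₊ + 1)] with k hk
    obtain ⟨k, rfl⟩ : ∃ j, k = j + 1 := ⟨k - 1, by omega⟩
    refine (rho_mono ((Nat.le_ceil ν).trans ?_) _).trans (h3 k (g k))
    exact_mod_cast Nat.le_of_succ_le_succ hk
  have hmem : ∀ n, f - g n - ∑ k ∈ Finset.range n, a k (g k) ∈ I := by
    intro n
    induction n with
    | zero => simp [hg0]
    | succ n ih =>
      have := I.add_mem ih (hnext n (g n))
      rw [← hg] at this
      rw [Finset.sum_range_succ]
      convert this using 1
      abel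
  refine ⟨x, ?_, ?_, ?_⟩
  · exact hA.mem_of_tendsto hx (Eventually.of_forall fun n => A.sum_mem fun k _ => ha k (g k))
  · have := ((tendsto_const_nhds (x := f)).sub hgt).sub hx
    rw [sub_zero] at this
    exact hI.mem_of_tendsto this (Eventually.of_forall hmem)
  · refine le_of_tendsto (((continuous_rho s).tendsto x).comp hx) (Eventually.of_forall fun n => ?_)
    have h4 : rho s (∑ k ∈ Finset.range n, a k (g k)) ≤
        ∑ k ∈ Finset.range n, rho s (a k (g k)) :=
      Finset.le_sum_of_subadditive (rho s) (map_zero _).le (map_add_le_add _) _ _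
    refine h4.trans ((Finset.sum_le_sum fun k _ => (rho_mono ?_ _).trans (hb k)).trans ?_)
    · exact (Nat.le_ceil s).trans (by exact_mod_cast Nat.le_add_right _ _)
    · refine (hgeo.sum_le_tsum _ fun k _ => ?_).trans_eq ?_
      · have := hC 0
        positivity
      · rw [tsum_mul_left, tsum_geometric_two]
        ring

theorem exists_rho_ball_subset {V : Set Smooth} {f : Smooth} (hV : V ∈ 𝓝 f) :
    ∃ ν : ℝ≥0, ∃ r > 0, ∀ g, rho ν g < r → f + g ∈ V := by
  obtain ⟨S, r, hr, h⟩ := (withSeminorms_rho.mem_nhds_iff f V).1 hV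
  refine ⟨S.sup id, r, hr, fun g hg => h ?_⟩
  rw [Seminorm.mem_ball, add_sub_cancel_left]
  refine lt_of_le_of_lt ?_ hg
  exact Seminorm.finset_sup_apply_le (apply_nonneg _ _) fun μ hμ =>
    rho_mono (Finset.le_sup (f := id) hμ) g

/-- Open mapping theorem: if `C^∞(𝕋) = A + I` with closed subspaces `A` and `I`, then the
decompositions can be chosen with bounds. -/
theorem exists_bounded_decomposition {A I : Submodule ℂ Smooth}
    (hA : IsClosed (A : Set Smooth)) (hI : IsClosed (I : Set Smooth))
    (h : ∀ f, ∃ a ∈ A, f - a ∈ I) (s : ℝ≥0) :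
    ∃ t : ℝ≥0, ∃ C > 0, ∀ f, ∃ a ∈ A, f - a ∈ I ∧ rho s a ≤ C * rho t f := by
  refine exists_decomposition_of_approximate hA hI (fun s => ?_) s
  -- By Baire's theorem the closure of some V n has interior. Only approximate decompositions
  -- result, which the reduction above permits.
  let V : ℕ → Set Smooth := fun n => {f | ∃ a ∈ A, f - a ∈ I ∧ rho s a ≤ n}
  have hU : ⋃ n, closure (V n) = univ := eq_univ_of_forall fun f => by
    obtain ⟨a, ha, hfa⟩ := h f
    obtain ⟨n, hn⟩ := exists_nat_ge (rho s a)
    exact mem_iUnion.2 ⟨n, subset_closure ⟨a, ha, hfa, hn⟩⟩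
  obtain ⟨n, x, hx⟩ := nonempty_interior_of_iUnion_of_closed (fun n => isClosed_closure) hU
  obtain ⟨t, r, hr, hball⟩ := exists_rho_ball_subset (mem_interior_iff_mem_nhds.1 hx)
  refine ⟨t, 4 * (n + 1) / r, by positivity, fun f q ε hε => ?_⟩
  by_cases hf : f = 0
  · exact ⟨0, A.zero_mem, 0, I.zero_mem, by simp [hf], by simpa [hf] using hε.le⟩
  set R := rho t f with hRdef
  have hR : 0 < R := (apply_nonneg _ _).lt_of_ne' fun h0 => hf (rho_eq_zero h0)
  -- This scaling puts c f in the ball of radius r. Subtracting decompositions of approximants to x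
  -- + c f and x bounds the a^∞-type component by 2n, and dividing by c gives the constant 4 (n + 1)
  -- / r; n + 1 keeps it positive.
  set c : ℝ := r / (2 * R) with hc
  have hc0 : 0 < c := by positivity
  have hcf : rho t ((c : ℂ) • f) < r := by
    rw [map_smul_eq_mul, Complex.norm_real, Real.norm_of_nonneg hc0.le, ← hRdef, hc]
    have : r / (2 * R) * R = r / 2 := by field_simp
    rw [this]
    exact half_lt_self hr
  obtain ⟨g₁, ⟨a₁, ha₁, hg₁, hb₁⟩, h₁⟩ := exists_rho_sub_le_of_mem_closure (hball _ hcf) q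
    (ε := c * ε / 2) (by positivity)
  obtain ⟨g₂, ⟨a₂, ha₂, hg₂, hb₂⟩, h₂⟩ := exists_rho_sub_le_of_mem_closure
    (interior_subset hx) q (ε := c * ε / 2) (by positivity)
  have hcne : (c : ℂ) ≠ 0 := by exact_mod_cast hc0.ne'
  refine ⟨(c : ℂ)⁻¹ • (a₁ - a₂), A.smul_mem _ (A.sub_mem ha₁ ha₂),
    (c : ℂ)⁻¹ • ((g₁ - a₁) - (g₂ - a₂)), I.smul_mem _ (I.sub_mem hg₁ hg₂), ?_, ?_⟩
  · rw [map_smul_eq_mul, norm_inv, Complex.norm_real, Real.norm_of_nonneg hc0.le]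
    have h3 : rho s (a₁ - a₂) ≤ 2 * (n + 1) :=
      (map_sub_le_add _ _ _).trans (by linarith)
    calc c⁻¹ * rho s (a₁ - a₂) ≤ c⁻¹ * (2 * (n + 1)) := by gcongr
      _ = 4 * (n + 1) / r * R := by rw [hc]; field_simp; ring
  · have h3 : f - (c : ℂ)⁻¹ • (a₁ - a₂) - (c : ℂ)⁻¹ • ((g₁ - a₁) - (g₂ - a₂)) =
        (c : ℂ)⁻¹ • ((x + (c : ℂ) • f - g₁) - (x - g₂)) := by
      have h4 : f = (c : ℂ)⁻¹ • ((c : ℂ) • f) := by rw [smul_smul, inv_mul_cancel₀ hcne, one_smul]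
      nth_rw 1 [h4]
      rw [← smul_sub, ← smul_sub]
      congr 1
      abel
    rw [h3, map_smul_eq_mul, norm_inv, Complex.norm_real, Real.norm_of_nonneg hc0.le]
    have h4 : rho q ((x + (c : ℂ) • f - g₁) - (x - g₂)) ≤ c * ε :=
      (map_sub_le_add _ _ _).trans (by linarith)
    calc _ ≤ c⁻¹ * (c * ε) := by gcongr
      _ = ε := by field_simp

/-! ### Interpolation sets and the coefficient estimate -/

theorem isInterpolationSet_iff {E : Set Circle} :
    IsInterpolationSet E ↔ ∀ f, ∃ a ∈ aInf, f - a ∈ idealInf E := by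
  refine forall_congr' fun f => exists_congr fun g => and_congr_right fun _ =>
    forall_congr' fun i => forall₂_congr fun z _ => ?_
  have : (D ^ i) (f - g) z = (D ^ i) f z - (D ^ i) g z := by rw [map_sub]; rfl
  rw [this, sub_eq_zero]

/-- Replacing n by -n turns indices n ≤ 0 of T̂ into the powers z^n with n ≥ 0, and a finite
supremum becomes an arbitrary bound M. An infinite right side makes the estimate vacuous, since C >
0. -/
theorem coeffEstimate_iff {E : Set Circle} :
    CoeffEstimate E ↔ ∀ s : ℝ≥0, ∃ C > 0, ∃ t : ℝ≥0, ∀ T ∈ annihilator (idealInf E), ∀ M ≥ 0,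
      (∀ n : ℤ, 0 ≤ n → ‖T (alphaPow n)‖ ≤ M * (1 + |(n : ℝ)|) ^ (s : ℝ)) →
        ∀ n : ℤ, ‖T (alphaPow n)‖ ≤ C * M * (1 + |(n : ℝ)|) ^ (t : ℝ) := by
  have hw : ∀ (n : ℤ) (s : ℝ), 0 < (1 + |(n : ℝ)|) ^ s := fun n s => by positivity
  constructor
  · intro h s
    obtain ⟨C, hC, t, ht, h⟩ := h s s.2
    refine ⟨C, hC, ⟨t, ht⟩, fun T hT M hM hb n => ?_⟩
    have h1 : (⨆ (n : ℤ) (_ : n ≤ 0), ENNReal.ofReal (‖distCoeff T n‖ / (1 + |(n : ℝ)|) ^ (s : ℝ)))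
        ≤ ENNReal.ofReal M := by
      refine iSup₂_le fun n hn => ENNReal.ofReal_le_ofReal ?_
      rw [div_le_iff₀ (hw _ _)]
      simpa [distCoeff] using hb (-n) (by omega)
    have h2 := (le_iSup (fun n : ℤ => ENNReal.ofReal (‖distCoeff T n‖ / (1 + |(n : ℝ)|) ^ t))
      (-n)).trans ((h T hT).trans (mul_le_mul_right h1 _))
    rw [← ENNReal.ofReal_mul hC.le, ENNReal.ofReal_le_ofReal_iff (by positivity),
      div_le_iff₀ (hw _ _)] at h2
    change ‖T (alphaPow n)‖ ≤ C * M * (1 + |(n : ℝ)|) ^ t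
    simpa [distCoeff] using h2
  · intro h s hs
    obtain ⟨C, hC, t, h⟩ := h ⟨s, hs⟩
    refine ⟨C, hC, t, t.2, fun T hT => ?_⟩
    set S := ⨆ (n : ℤ) (_ : n ≤ 0), ENNReal.ofReal (‖distCoeff T n‖ / (1 + |(n : ℝ)|) ^ s) with hS
    by_cases hST : S = ⊤
    · rw [hST, ENNReal.mul_top (by simpa using hC)]
      exact le_top
    refine iSup_le fun n => ?_
    have h1 : ∀ n : ℤ, 0 ≤ n → ‖T (alphaPow n)‖ ≤ S.toReal * (1 + |(n : ℝ)|) ^ s := fun n hn => by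
      have h2 := le_iSup₂ (f := fun (n : ℤ) (_ : n ≤ 0) =>
        ENNReal.ofReal (‖distCoeff T n‖ / (1 + |(n : ℝ)|) ^ s)) (-n) (by omega)
      rw [← hS, ENNReal.ofReal_le_iff_le_toReal hST, div_le_iff₀ (hw _ _)] at h2
      simpa [distCoeff] using h2
    have h3 := h T hT S.toReal ENNReal.toReal_nonneg h1 (-n)
    rw [← ENNReal.ofReal_toReal hST, ← ENNReal.ofReal_mul hC.le]
    refine ENNReal.ofReal_le_ofReal ?_
    rw [div_le_iff₀ (hw _ _)]
    simpa [distCoeff] using h3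

theorem norm_distribution_le_of_mem_aInf {T : Distribution} {s : ℝ≥0} {M : ℝ}
    (h : ∀ n : ℤ, 0 ≤ n → ‖T (alphaPow n)‖ ≤ M * (1 + |(n : ℝ)|) ^ (s : ℝ)) {a : Smooth}
    (ha : a ∈ aInf) : ‖T a‖ ≤ M * rho s a := by
  have h1 : ∀ n : ℤ, ‖coeff a n * T (alphaPow n)‖ ≤
      M * (‖coeff a n‖ * (1 + |(n : ℝ)|) ^ (s : ℝ)) := fun n => by
    rcases lt_or_ge n 0 with hn | hn
    · simp [mem_aInf_iff.1 ha n hn]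
    rw [norm_mul]
    calc _ ≤ ‖coeff a n‖ * (M * (1 + |(n : ℝ)|) ^ (s : ℝ)) := by gcongr; exact h n hn
      _ = _ := by ring
  rw [← (hasSum_coeff_mul_distribution T a).tsum_eq, rho_apply, ← tsum_mul_left]
  exact tsum_of_norm_bounded ((summable_rho s a).mul_left M).hasSum h1

theorem IsInterpolationSet.coeffEstimate {E : Set Circle} (h : IsInterpolationSet E) :
    CoeffEstimate E := by
  refine coeffEstimate_iff.2 fun s => ?_
  obtain ⟨t, C, hC, h⟩ := exists_bounded_decomposition isClosed_aInf (isClosed_idealInf E)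
    (isInterpolationSet_iff.1 h) s
  refine ⟨C, hC, t, fun T hT M hM hb n => ?_⟩
  obtain ⟨a, ha, hi, hle⟩ := h (alphaPow n)
  have h1 : T (alphaPow n) = T a := by
    rw [← sub_eq_zero, ← map_sub]
    exact hT _ hi
  rw [h1]
  calc ‖T a‖ ≤ M * rho s a := norm_distribution_le_of_mem_aInf hb ha
    _ ≤ M * (C * rho t (alphaPow n)) := by gcongr
    _ = C * M * (1 + |(n : ℝ)|) ^ (t : ℝ) := by rw [rho_alphaPow]; ring

/-- Two choices of a for the same f differ by an element of I_∞^+(E), which T kills. So f ↦ T(a) is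
linear although the choice of a is not. -/
theorem IsInterpolationSet.annihilatorSplits {E : Set Circle} (h : IsInterpolationSet E) :
    AnnihilatorSplits E := by
  refine le_antisymm (fun T hT => ?_) (sup_le ?_ ?_)
  · obtain ⟨K, hK, ν, hTν⟩ := exists_norm_distribution_le T
    obtain ⟨t, C, hC, h⟩ := exists_bounded_decomposition isClosed_aInf (isClosed_idealInf E)
      (isInterpolationSet_iff.1 h) ν
    choose a ha hi hle using h
    have key : ∀ f g : Smooth, f ∈ aInf → g ∈ aInf → f - g ∈ idealInf E → T f = T g :=
      fun f g hf hg hfg => by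
        rw [← sub_eq_zero, ← map_sub]
        exact hT _ ⟨hfg, aInf.sub_mem hf hg⟩
    let S : Distribution := mkDistribution
      { toFun := fun f => T (a f)
        map_add' := fun f g => by
          rw [← map_add]
          refine key _ _ (ha _) (aInf.add_mem (ha _) (ha _)) ?_
          convert (idealInf E).sub_mem ((idealInf E).add_mem (hi f) (hi g)) (hi (f + g)) using 1
          abel
        map_smul' := fun c f => by
          rw [RingHom.id_apply, ← map_smul]
          refine key _ _ (ha _) (aInf.smul_mem _ (ha _)) ?_
          convert (idealInf E).sub_mem ((idealInf E).smul_mem c (hi f)) (hi (c • f)) using 1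
          rw [smul_sub]
          abel } t (K * C) fun f => by
        change ‖T (a f)‖ ≤ _
        rw [mul_assoc]
        exact (hTν _).trans (mul_le_mul_of_nonneg_left (hle f) hK.le)
    have hS : ∀ f, S f = T (a f) := fun _ => rfl
    refine Submodule.mem_sup.2 ⟨S, fun f hf => ?_, T - S, fun f hf => ?_, add_sub_cancel _ _⟩
    · rw [hS, ← map_zero T]
      refine key _ _ (ha f) aInf.zero_mem ?_
      have := (idealInf E).sub_mem hf (hi f)
      rwa [sub_sub_cancel, ← sub_zero (a f)] at this
    · rw [_root_.sub_apply, hS, sub_eq_zero]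
      exact key _ _ hf (ha f) (hi f)
  · exact fun T hT f hf => hT f hf.1
  · exact fun T hT f hf => hT f hf.2

theorem CoeffEstimate.isInterpolationSet {E : Set Circle} (h : CoeffEstimate E) :
    IsInterpolationSet E := by
  rw [coeffEstimate_iff] at h
  refine isInterpolationSet_iff.2 fun f => ?_
  suffices happ : ∀ s : ℕ, ∃ t : ℝ≥0, ∃ C > 0, ∀ f, ∀ r : ℝ≥0, ∀ ε > 0,
      ∃ a ∈ aInf, ∃ i ∈ idealInf E, rho s a ≤ C * rho t f ∧ rho r (f - a - i) ≤ ε by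
    obtain ⟨_, _, _, hd⟩ :=
      exists_decomposition_of_approximate isClosed_aInf (isClosed_idealInf E) happ 0
    obtain ⟨a, ha, hi, _⟩ := hd f
    exact ⟨a, ha, hi⟩
  intro s
  obtain ⟨C, hC, t, h⟩ := h s
  refine ⟨t, C, hC, fun f r ε hε => ?_⟩
  set R := rho t f with hRdef
  -- V is convex, contains I_∞(E), and contains the ball of radius C R in a^∞ for ρ_s. A functional
  -- T separating f from V kills I_∞(E) and is at most u / (C R) times the weight on z^n, n ≥ 0; the
  -- estimate then gives |T f| ≤ u, a contradiction.
  let V : Set Smooth := {g | ∃ a ∈ aInf, g - a ∈ idealInf E ∧ rho s a ≤ C * R}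
  suffices hf : f ∈ closure V by
    obtain ⟨g, ⟨a, ha, hi, hb⟩, hg⟩ := exists_rho_sub_le_of_mem_closure hf r hε
    refine ⟨a, ha, g - a, hi, hb, ?_⟩
    rwa [sub_sub_sub_cancel_right]
  by_contra hf
  have hconv : Convex ℝ V := by
    rintro g₁ ⟨a₁, ha₁, hi₁, hb₁⟩ g₂ ⟨a₂, ha₂, hi₂, hb₂⟩ p q hp hq hpq
    refine ⟨(p : ℂ) • a₁ + (q : ℂ) • a₂,
      aInf.add_mem (aInf.smul_mem _ ha₁) (aInf.smul_mem _ ha₂), ?_, ?_⟩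
    · convert (idealInf E).add_mem ((idealInf E).smul_mem (p : ℂ) hi₁)
        ((idealInf E).smul_mem (q : ℂ) hi₂) using 1
      rw [← Complex.coe_smul, ← Complex.coe_smul, smul_sub, smul_sub]
      abel
    · refine (map_add_le_add _ _ _).trans ?_
      rw [map_smul_eq_mul, map_smul_eq_mul, Complex.norm_real, Complex.norm_real,
        Real.norm_of_nonneg hp, Real.norm_of_nonneg hq]
      calc p * rho s a₁ + q * rho s a₂ ≤ p * (C * R) + q * (C * R) := by gcongr
        _ = C * R := by rw [← add_mul, hpq, one_mul]
  obtain ⟨T, u, hT, hu⟩ := RCLike.geometric_hahn_banach_closed_point (𝕜 := ℂ) hconv.closure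
    isClosed_closure hf
  have hTV : ∀ g ∈ V, (T g).re < u := fun g hg => hT g (subset_closure hg)
  have hR0 : 0 ≤ R := apply_nonneg _ _
  have hTI : T ∈ annihilator (idealInf E) := fun i hi => by
    by_contra hne
    -- If T i ≠ 0, this multiple of i lies in V and T takes the excluded value u on it.
    have h1 := hTV (((u : ℂ) / T i) • i) ⟨0, aInf.zero_mem, by
      rw [sub_zero]; exact (idealInf E).smul_mem _ hi, by rw [map_zero]; positivity⟩
    rw [map_smul, smul_eq_mul, div_mul_cancel₀ _ hne, Complex.ofReal_re] at h1
    exact lt_irrefl _ h1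
  have hu0 : 0 < u := by
    have := hTV 0 ⟨0, aInf.zero_mem, by simp, by rw [map_zero]; positivity⟩
    simpa using this
  have hR : 0 < R := hR0.lt_of_ne' fun h0 => by
    have hf0 := rho_eq_zero (hRdef.symm.trans h0)
    change u < (T f).re at hu
    rw [hf0, map_zero, Complex.zero_re] at hu
    exact hu.not_gt hu0
  have hb : ∀ n : ℤ, 0 ≤ n → ‖T (alphaPow n)‖ ≤ u / (C * R) * (1 + |(n : ℝ)|) ^ ((s : ℝ≥0) : ℝ) := by
    intro n hn
    obtain ⟨c, hc, hcn⟩ : ∃ c : ℂ, ‖c‖ = 1 ∧ c * T (alphaPow n) = ‖T (alphaPow n)‖ := by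
      obtain ⟨c, hc, h⟩ := RCLike.exists_norm_eq_mul_self (T (alphaPow n))
      exact ⟨c, hc, h.symm⟩
    set w : ℝ := (1 + |(n : ℝ)|) ^ ((s : ℝ≥0) : ℝ) with hw
    have hw0 : 0 < w := by positivity
    -- The test function has ρ_s exactly C R, and the phase c makes T real and nonnegative on it.
    have h1 := hTV ((((C * R / w : ℝ) : ℂ) * c) • alphaPow n)
      ⟨_, aInf.smul_mem _ (alphaPow_mem_aInf hn), by rw [sub_self]; exact (idealInf E).zero_mem, by
        rw [map_smul_eq_mul, rho_alphaPow, norm_mul, hc, mul_one, Complex.norm_real,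
          Real.norm_of_nonneg (by positivity), ← hw, div_mul_cancel₀ _ hw0.ne']⟩
    rw [map_smul, smul_eq_mul, mul_assoc, hcn, ← Complex.ofReal_mul, Complex.ofReal_re] at h1
    rw [div_mul_eq_mul_div, le_div_iff₀ (by positivity)]
    rw [div_mul_eq_mul_div, div_lt_iff₀ hw0] at h1
    linarith
  have h1 := norm_distribution_le (h T hTI _ (by positivity) hb) f
  have h2 : C * (u / (C * R)) * R = u := by field_simp
  rw [← hRdef, h2] at h1
  exact (hu.trans_le (Complex.re_le_norm (T f))).not_ge h1

/-! ### Uniqueness: `a^∞ + I_∞(E)` is dense if `E ≠ 𝕋` -/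

/-- By the identity theorem, analytic functions on a connected set have no zero divisors. -/
theorem eq_zero_of_prod_eq_zero {ι : Type*} {U : Set ℂ} (hU : IsPreconnected U) (hne : U.Nonempty)
    (S : Finset ι) {F : ι → ℂ → ℂ} (hF : ∀ i ∈ S, AnalyticOnNhd ℂ (F i) U)
    (h : ∀ z ∈ U, ∏ i ∈ S, F i z = 0) : ∃ i ∈ S, ∀ z ∈ U, F i z = 0 := by
  classical
  induction S using Finset.induction_on with
  | empty =>
    obtain ⟨z, hz⟩ := hne
    simpa using h z hz
  | insert a S ha ih =>
    simp only [Finset.prod_insert ha] at h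
    have hS : AnalyticOnNhd ℂ (fun z => ∏ i ∈ S, F i z) U :=
      Finset.analyticOnNhd_fun_prod S fun i hi => hF i (Finset.mem_insert_of_mem hi)
    rcases (hF a (Finset.mem_insert_self a S)).eq_zero_or_eq_zero_of_mul_eq_zero hS h hU with h1 | h1
    · exact ⟨a, Finset.mem_insert_self a S, h1⟩
    · obtain ⟨i, hi, h2⟩ := ih (fun i hi => hF i (Finset.mem_insert_of_mem hi)) h1
      exact ⟨i, Finset.mem_insert_of_mem hi, h2⟩

/-- A function of `a^∞` that vanishes on an arc vanishes: the product of sufficiently many of its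
rotates vanishes on the whole circle. -/
theorem eq_zero_of_mem_aInf_of_eqOn_ball {f : Smooth} (hf : f ∈ aInf) (w : Circle) {r : ℝ}
    (hr : 0 < r) (h : ∀ z : Circle, dist z w < r → f z = 0) : f = 0 := by
  obtain ⟨F, hF, hFf⟩ := hf
  obtain ⟨S, hS⟩ := isCompact_univ.elim_finite_subcover
    (fun u : Circle => {z : Circle | dist (u * z) w < r})
    (fun u => isOpen_lt ((continuous_const.mul continuous_id).dist continuous_const)
      continuous_const)
    (fun z _ => mem_iUnion.2 ⟨w * z⁻¹, by simpa using hr⟩)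
  have hrot : ∀ u : Circle, DiffContOnCl ℂ (fun z : ℂ => F (u * z)) (Metric.ball 0 1) := fun u => by
    refine hF.comp ((differentiable_id.const_mul (u : ℂ)).diffContOnCl) fun z hz => ?_
    simpa [Circle.norm_coe u] using hz
  have hprod : ∀ S : Finset Circle,
      DiffContOnCl ℂ (fun z : ℂ => ∏ u ∈ S, F (u * z)) (Metric.ball 0 1) := fun S => by
    classical
    induction S using Finset.induction_on with
    | empty => simpa using diffContOnCl_const
    | insert a S ha ih =>
      simp only [Finset.prod_insert ha]
      exact (hrot a).smul ih
  -- Each boundary point is carried into the arc by one of the rotations, so the product vanishes on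
  -- the circle, and inside by the maximum principle.
  have hzero : ∀ z ∈ Metric.ball (0 : ℂ) 1, ∏ u ∈ S, F (u * z) = 0 := fun z hz => by
    refine Complex.eqOn_of_eqOn_frontier Metric.isBounded_ball (hprod S)
      (g := fun _ => 0) diffContOnCl_const (fun z hz => ?_) hz
    rw [frontier_ball _ one_ne_zero, mem_sphere_zero_iff_norm] at hz
    let ζ : Circle := ⟨z, mem_sphere_zero_iff_norm.2 hz⟩
    obtain ⟨u, hu⟩ := mem_iUnion.1 (hS (mem_univ ζ))
    obtain ⟨hu, huζ⟩ := mem_iUnion.1 hu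
    refine Finset.prod_eq_zero hu ?_
    have h1 := hFf (u * ζ)
    rw [h _ huζ, Circle.coe_mul] at h1
    exact h1
  obtain ⟨u, -, hu⟩ := eq_zero_of_prod_eq_zero (convex_ball (0 : ℂ) 1).isPreconnected
    ⟨0, by simp⟩ S (F := fun (u : Circle) z => F (u * z))
    (fun u _ => (hrot u).differentiableOn.analyticOnNhd Metric.isOpen_ball) hzero
  have hF0 : EqOn F (fun _ => 0) (Metric.ball 0 1) := fun z hz => by
    have h1 := hu ((u⁻¹ : Circle) * z) (by simpa [Circle.norm_coe u] using hz)
    rwa [← mul_assoc, ← Circle.coe_mul, mul_inv_cancel, Circle.coe_one, one_mul] at h1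
  have hF1 : EqOn F (fun _ => 0) (closure (Metric.ball 0 1)) :=
    hF0.of_subset_closure hF.continuousOn continuousOn_const subset_closure subset_rfl
  refine Smooth.ext fun z => ?_
  rw [← hFf, Smooth.zero_apply]
  refine hF1 ?_
  rw [closure_ball _ one_ne_zero, mem_closedBall_zero_iff, Circle.norm_coe]

theorem mem_idealInf_of_eqOn_zero {E U : Set Circle} (hU : IsOpen U) (hEU : E ⊆ U) {f : Smooth}
    (hf : ∀ z ∈ U, f z = 0) : f ∈ idealInf E := by
  suffices ∀ i : ℕ, ∀ z ∈ U, (D ^ i) f z = 0 from fun i z hz => this i z (hEU hz)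
  intro i
  induction i with
  | zero => simpa using hf
  | succ i ih =>
    intro z hz
    rw [pow_succ', Module.End.mul_apply, D_apply, circleDeriv]
    have h1 : (fun t : ℝ => (D ^ i) f (z * Circle.exp t)) =ᶠ[𝓝 0] fun _ => 0 := by
      have h2 : ContinuousAt (fun t : ℝ => z * Circle.exp t) 0 := by fun_prop
      refine (h2.eventually (hU.mem_nhds (by simpa using hz))).mono fun t ht => ih _ ht
    rw [h1.deriv_eq, deriv_const, zero_div]

theorem circle_dist_eq (z w : Circle) : dist z w = ‖(z : ℂ) - w‖ := dist_eq_norm (z : ℂ) w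

theorem dist_circle_one_sq (t : ℝ) : dist (Circle.exp t) 1 ^ 2 = 2 - 2 * Real.cos t := by
  rw [circle_dist_eq, Circle.coe_exp, Circle.coe_one, ← Complex.normSq_eq_norm_sq,
    Complex.normSq_apply]
  simp only [Complex.sub_re, Complex.exp_ofReal_mul_I_re, Complex.one_re, Complex.sub_im,
    Complex.exp_ofReal_mul_I_im, Complex.one_im]
  nlinarith [Real.sin_sq_add_cos_sq t]

/-- A smooth function supported near `1` with a prescribed nonzero Fourier coefficient. -/
theorem exists_bump {r : ℝ} (hr : 0 < r) (m : ℤ) :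
    ∃ φ : Smooth, (∀ z : Circle, r ≤ dist z 1 → φ z = 0) ∧ coeff φ m ≠ 0 := by
  -- Since |e^{it} - 1|² = 2 - 2 cos t, b is positive exactly at distance less than r from 1. The
  -- factor z^m makes the m-th coefficient of φ the mean of b.
  let b : ℝ → ℝ := fun t => expNegInvGlue (r ^ 2 - (2 - 2 * Real.cos t))
  have hb : ContDiff ℝ ∞ b := expNegInvGlue.contDiff.comp (by fun_prop)
  let φ : Circle → ℂ := fun z =>
    (z : ℂ) ^ m * ((expNegInvGlue (r ^ 2 - (2 - 2 * (z : ℂ).re)) : ℝ) : ℂ)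
  have hφ : ∀ t : ℝ, φ (Circle.exp t) = Complex.exp (m * t * Complex.I) * (b t : ℂ) := fun t => by
    change ((Circle.exp t : Circle) : ℂ) ^ m * _ = _
    rw [Circle.coe_exp, ← Complex.exp_int_mul, Complex.exp_ofReal_mul_I_re, mul_assoc]
  have hs : ContMDiff (𝓡 1) 𝓘(ℝ, ℂ) ∞ φ := by
    refine (contMDiff_iff_contDiff_exp _).2 ?_
    simp only [hφ]
    have h0 : ContDiff ℝ ∞ (fun t : ℝ => (t : ℂ)) := Complex.ofRealCLM.contDiff
    have h1 : ContDiff ℝ ∞ (fun t : ℝ => (b t : ℂ)) := Complex.ofRealCLM.contDiff.comp hb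
    fun_prop
  refine ⟨⟨φ, hs⟩, fun z hz => ?_, ?_⟩
  · obtain ⟨t, rfl⟩ : ∃ t : ℝ, Circle.exp t = z := ⟨_, Circle.exp_arg z⟩
    change φ _ = 0
    have h1 : r ^ 2 ≤ dist (Circle.exp t) 1 ^ 2 := by gcongr
    rw [dist_circle_one_sq] at h1
    have h2 : b t = 0 := expNegInvGlue.zero_of_nonpos (by linarith)
    rw [hφ, h2, Complex.ofReal_zero, mul_zero]
  · have hint : 0 < ∫ t in (0 : ℝ)..(2 * π), b t := by
      refine intervalIntegral.integral_pos Real.two_pi_pos hb.continuous.continuousOn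
        (fun t _ => expNegInvGlue.nonneg _) ⟨0, ⟨le_rfl, Real.two_pi_pos.le⟩, ?_⟩
      refine expNegInvGlue.pos_of_pos ?_
      rw [Real.cos_zero]
      nlinarith
    change coeff φ m ≠ 0
    rw [coeff_eq_integral]
    have h1 : ∀ t : ℝ, Complex.exp (-(m * t * Complex.I)) * φ (Circle.exp t) = (b t : ℂ) :=
      fun t => by rw [hφ, ← mul_assoc, ← Complex.exp_add, neg_add_cancel, Complex.exp_zero, one_mul]
    simp only [h1]
    rw [intervalIntegral.integral_ofReal]
    have hpi := Real.two_pi_pos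
    refine smul_ne_zero (by positivity) (by exact_mod_cast hint.ne')

/-- If `E` is a proper closed subset of the circle, then no nonzero distribution vanishes on both
`I_∞(E)` and `a^∞`. -/
theorem eq_zero_of_mem_annihilators {E : Set Circle} (hE : IsClosed E) (hne : E ≠ univ)
    {T : Distribution} (hTE : T ∈ annihilator (idealInf E)) (hTA : T ∈ annihilator aInf) :
    T = 0 := by
  obtain ⟨w₀, hw₀⟩ := (ne_univ_iff_exists_notMem E).1 hne
  obtain ⟨r, hr, hball⟩ := Metric.isOpen_iff.1 hE.isOpen_compl w₀ hw₀
  refine distribution_ext fun m => ?_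
  rw [_root_.zero_apply]
  obtain ⟨φ, hφ, hφm⟩ := exists_bump (half_pos hr) (-m)
  obtain ⟨C, hC, ν, hTν⟩ := exists_norm_distribution_le T
  -- g is the convolution of T with φ. It lies in a^∞ because T kills a^∞, and it will vanish near
  -- w₀ because T kills I_∞(E); hence g = 0, and φ̂(-m) ≠ 0 forces T(z^m) = 0.
  obtain ⟨g, hg⟩ := exists_smooth_of_summable (c := fun n => coeff φ n * T (alphaPow (-n)))
    fun k => by
      refine Summable.of_nonneg_of_le (fun n => by positivity) (fun n => ?_)
        ((summable_rho (ν + k) φ).mul_left C)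
      have h1 := hTν (alphaPow (-n))
      rw [rho_alphaPow, Int.cast_neg, abs_neg] at h1
      rw [norm_mul, NNReal.coe_add, NNReal.coe_natCast, Real.rpow_add (by positivity),
        Real.rpow_natCast]
      calc ‖coeff φ n‖ * ‖T (alphaPow (-n))‖ * (1 + |(n : ℝ)|) ^ k
          ≤ ‖coeff φ n‖ * (C * (1 + |(n : ℝ)|) ^ (ν : ℝ)) * (1 + |(n : ℝ)|) ^ k := by gcongr
        _ = _ := by ring
  have hgA : g ∈ aInf := mem_aInf_iff.2 fun n hn => by
    rw [hg, hTA _ (alphaPow_mem_aInf (by omega)), mul_zero]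
  have hg0 : g = 0 := by
    refine eq_zero_of_mem_aInf_of_eqOn_ball hgA w₀ (half_pos hr) fun w hw => ?_
    -- h is ζ ↦ φ(w / ζ), and g(w) = T h. It vanishes at distance at least r/2 from w, so on a
    -- neighbourhood of E when w is within r/2 of w₀.
    obtain ⟨h, hh⟩ := exists_smooth_of_summable (c := fun n => coeff φ (-n) * (w : ℂ) ^ (-n))
      fun k => by
        simp only [norm_mul, norm_circle_zpow, mul_one]
        refine ((Equiv.neg ℤ).summable_iff.2 (summable_rho k φ)).congr fun n => ?_
        simp
    have hval : ∀ ζ : Circle, h ζ = φ (w / ζ) := fun ζ => by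
      refine (hasSum_coeff_mul_zpow h ζ).unique ?_
      refine ((Equiv.neg ℤ).hasSum_iff.2 (hasSum_coeff_mul_zpow φ (w / ζ))).congr_fun fun n => ?_
      simp only [hh, Function.comp_apply, Equiv.neg_apply, Circle.coe_div, div_zpow, zpow_neg,
        div_inv_eq_mul]
      ring
    have hE' : h ∈ idealInf E := by
      refine mem_idealInf_of_eqOn_zero (U := {ζ | r / 2 < dist w ζ})
        (isOpen_lt continuous_const (continuous_const.dist continuous_id)) (fun ζ hζ => ?_)
        fun ζ hζ => ?_
      · by_contra hlt
        refine hball (Metric.mem_ball.2 ?_) hζ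
        have h1 := dist_triangle ζ w w₀
        rw [dist_comm ζ w] at h1
        have h2 : dist w ζ ≤ r / 2 := not_lt.1 hlt
        linarith
      · rw [hval]
        refine hφ _ (le_of_lt ?_)
        have h1 : dist (w / ζ) 1 = dist w ζ := by
          rw [circle_dist_eq, circle_dist_eq, Circle.coe_div,
            Circle.coe_one, div_sub_one (Circle.coe_ne_zero ζ), norm_div, Circle.norm_coe, div_one]
        rw [h1]
        exact hζ
    have hgw : g w = T h := by
      refine (hasSum_coeff_mul_zpow g w).unique ?_
      refine ((Equiv.neg ℤ).hasSum_iff.2 (hasSum_coeff_mul_distribution T h)).congr_fun fun n => ?_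
      simp only [hg, hh, Function.comp_apply, Equiv.neg_apply, neg_neg]
      ring
    rw [hgw, hTE h hE']
  have h1 := hg (-m)
  rw [hg0, coeff_zero, neg_neg] at h1
  exact (mul_eq_zero.1 h1.symm).resolve_left hφm

/-! ### From the splitting of annihilators to the coefficient estimate -/

/-- The sequences `(T(α^n))` for `T ∈ V^⊥` with `|T(α^n)| ≤ M (1 + |n|)^ν`. -/
def dualBall (V : Submodule ℂ Smooth) (M : ℝ) (ν : ℝ≥0) : Set (ℤ → ℂ) :=
  {c | (∃ T ∈ annihilator V, ∀ n, T (alphaPow n) = c n) ∧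
    ∀ n : ℤ, ‖c n‖ ≤ M * (1 + |(n : ℝ)|) ^ (ν : ℝ)}

theorem isCompact_dualBall (V : Submodule ℂ Smooth) (M : ℝ) (ν : ℝ≥0) :
    IsCompact (dualBall V M ν) := by
  let B : Set (ℤ → ℂ) :=
    Set.pi univ fun n : ℤ => Metric.closedBall 0 (M * (1 + |(n : ℝ)|) ^ (ν : ℝ))
  have hB : ∀ {c}, c ∈ B ↔ ∀ n : ℤ, ‖c n‖ ≤ M * (1 + |(n : ℝ)|) ^ (ν : ℝ) := by simp [B]
  have hBc : IsCompact B := isCompact_univ_pi fun n => isCompact_closedBall _ _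
  have hcont : ∀ f : Smooth, ContinuousOn (fun c : ℤ → ℂ => ∑' n, coeff f n * c n) B := fun f => by
    refine continuousOn_tsum (fun n => (continuous_const.mul (continuous_apply n)).continuousOn)
      ((summable_rho ν f).mul_left M) fun n c hc => ?_
    rw [norm_mul]
    calc _ ≤ ‖coeff f n‖ * (M * (1 + |(n : ℝ)|) ^ (ν : ℝ)) := by gcongr; exact hB.1 hc n
      _ = _ := by ring
  -- B is repeated inside the intersection because the pairing with f is continuous for pointwise
  -- convergence only on B, by dominated convergence.
  have heq : dualBall V M ν = B ∩ ⋂ f ∈ V, B ∩ {c | ∑' n, coeff f n * c n = 0} := by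
    ext c
    simp only [mem_inter_iff, mem_iInter, mem_ofPred_eq]
    constructor
    · rintro ⟨⟨T, hT, hc⟩, hb⟩
      refine ⟨hB.2 hb, fun f hf => ⟨hB.2 hb, ?_⟩⟩
      simp only [← hc, (hasSum_coeff_mul_distribution T f).tsum_eq, hT f hf]
    · rintro ⟨hb, hV⟩
      obtain ⟨T, hT⟩ := exists_distribution (hB.1 hb)
      refine ⟨⟨T, fun f hf => ?_, hT⟩, hB.1 hb⟩
      rw [← (hasSum_coeff_mul_distribution T f).tsum_eq]
      simp only [hT, (hV f hf).2]
  rw [heq]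
  refine hBc.inter_right (isClosed_biInter fun f _ => ?_)
  exact (hcont f).preimage_isClosed_of_isClosed hBc.isClosed isClosed_singleton

theorem dualBall_mono {V : Submodule ℂ Smooth} {M N : ℝ} {ν μ : ℝ≥0} (hM : 0 ≤ M) (h : M ≤ N)
    (h' : ν ≤ μ) : dualBall V M ν ⊆ dualBall V N μ := fun c hc => ⟨hc.1, fun n => (hc.2 n).trans <| by
  have := one_le_one_add_abs n
  have := hM.trans h
  gcongr⟩

theorem dualBall_smul_add {V : Submodule ℂ Smooth} {M N : ℝ} {ν : ℝ≥0} {c d : ℤ → ℂ}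
    (hc : c ∈ dualBall V M ν) (hd : d ∈ dualBall V N ν) (p q : ℂ) :
    p • c + q • d ∈ dualBall V (‖p‖ * M + ‖q‖ * N) ν := by
  obtain ⟨⟨S, hS, hSc⟩, hc⟩ := hc
  obtain ⟨⟨T, hT, hTd⟩, hd⟩ := hd
  refine ⟨⟨p • S + q • T, add_mem (Submodule.smul_mem _ _ hS) (Submodule.smul_mem _ _ hT),
    fun n => ?_⟩, fun n => ?_⟩
  · simp [hSc, hTd]
  · simp only [Pi.add_apply, Pi.smul_apply, smul_eq_mul]
    refine (norm_add_le _ _).trans ?_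
    rw [norm_mul, norm_mul, add_mul, mul_assoc, mul_assoc]
    gcongr
    · exact hc n
    · exact hd n

/-- The restriction of a sequence to nonnegative indices. -/
def nonnegPart (c : ℤ → ℂ) (n : ℤ) : ℂ := if 0 ≤ n then c n else 0

theorem continuous_nonnegPart : Continuous nonnegPart :=
  continuous_pi fun n => by
    unfold nonnegPart
    split_ifs
    · exact continuous_apply n
    · exact continuous_const

theorem nonnegPart_smul_add (p q : ℂ) (c d : ℤ → ℂ) :
    nonnegPart (p • c + q • d) = p • nonnegPart c + q • nonnegPart d := by
  funext n
  by_cases hn : 0 ≤ n <;> simp [nonnegPart, hn]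

/-- A uniform boundedness argument. Splitting T = S + U with U in (a^∞)^⊥ leaves the coefficients of
index n ≥ 0 unchanged, so the closed sets Q m cover P. P is compact Hausdorff, hence Baire, and some
Q m contains a relatively open part of P; convexity spreads this over P. -/
theorem AnnihilatorSplits.exists_dualBall {E : Set Circle} (h : AnnihilatorSplits E) (s : ℝ≥0) :
    ∃ (C : ℝ) (t : ℝ≥0), 0 < C ∧ ∀ c ∈ dualBall (idealInfPlus E) 1 s, nonnegPart c = c →
      ∃ k ∈ dualBall (idealInf E) C t, nonnegPart k = c := by
  let P : Set (ℤ → ℂ) := dualBall (idealInfPlus E) 1 s ∩ {c | nonnegPart c = c}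
  have hP : IsCompact P := (isCompact_dualBall _ _ _).inter_right
    (isClosed_eq continuous_nonnegPart continuous_id)
  have hP0 : (0 : ℤ → ℂ) ∈ P :=
    ⟨⟨⟨0, zero_mem _, fun n => rfl⟩, fun n => by rw [Pi.zero_apply, norm_zero]; positivity⟩, by
      funext n; simp [nonnegPart]⟩
  have hPconv : ∀ c ∈ P, ∀ d ∈ P, ∀ l : ℝ, 0 ≤ l → l ≤ 1 →
      (((1 - l : ℝ) : ℂ) • c + (l : ℂ) • d) ∈ P := fun c hc d hd l h0 h1 => by
    refine ⟨?_, ?_⟩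
    · have := dualBall_smul_add hc.1 hd.1 ((1 - l : ℝ) : ℂ) (l : ℂ)
      rwa [Complex.norm_real, Complex.norm_real, Real.norm_of_nonneg (by linarith),
        Real.norm_of_nonneg h0, mul_one, mul_one, sub_add_cancel] at this
    · change nonnegPart _ = _
      rw [nonnegPart_smul_add, hc.2, hd.2]
  let Q : ℕ → Set (ℤ → ℂ) := fun m => nonnegPart '' dualBall (idealInf E) m m
  have hQ : ∀ m, IsClosed (Q m) := fun m =>
    ((isCompact_dualBall _ _ _).image continuous_nonnegPart).isClosed
  have hcover : ∀ c ∈ P, ∃ m, c ∈ Q m := by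
    rintro c ⟨⟨⟨T, hT, hTc⟩, -⟩, hc⟩
    rw [h] at hT
    obtain ⟨S, hS, U, hU, rfl⟩ := Submodule.mem_sup.1 hT
    obtain ⟨K, hK, ν, hSν⟩ := exists_norm_distribution_le S
    obtain ⟨m, hm⟩ := exists_nat_ge (max K ν)
    refine ⟨m, fun n => S (alphaPow n), dualBall_mono hK.le ((le_max_left _ _).trans hm)
      (by exact_mod_cast (le_max_right _ _).trans hm) ⟨⟨S, hS, fun n => rfl⟩, fun n => ?_⟩, ?_⟩
    · exact (hSν _).trans_eq (by rw [rho_alphaPow])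
    · rw [← hc]
      funext n
      unfold nonnegPart
      split_ifs with hn
      · rw [← hTc, _root_.add_apply, hU _ (alphaPow_mem_aInf hn), add_zero]
      · rfl
  have : CompactSpace P := isCompact_iff_compactSpace.1 hP
  have : Nonempty P := ⟨⟨0, hP0⟩⟩
  obtain ⟨m, ⟨x₀, hx₀P⟩, hx₀⟩ := nonempty_interior_of_iUnion_of_closed
    (f := fun m => (Subtype.val ⁻¹' Q m : Set P))
    (fun m => (hQ m).preimage continuous_subtype_val)
    (eq_univ_of_forall fun c => mem_iUnion.2 (hcover c c.2))
  obtain ⟨U, hU, hx₀U, hUQ⟩ : ∃ U : Set (ℤ → ℂ), IsOpen U ∧ x₀ ∈ U ∧ ∀ c ∈ P, c ∈ U → c ∈ Q m := by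
    obtain ⟨U, hU, hUeq⟩ := isOpen_induced_iff.1 (isOpen_interior (s := (Subtype.val ⁻¹' Q m : Set P)))
    rw [← hUeq] at hx₀
    refine ⟨U, hU, hx₀, fun c hc hcU => ?_⟩
    have : (⟨c, hc⟩ : P) ∈ interior (Subtype.val ⁻¹' Q m : Set P) := by rw [← hUeq]; exact hcU
    exact (interior_subset this : (⟨c, hc⟩ : P) ∈ (Subtype.val ⁻¹' Q m : Set P))
  -- At l = 0 the point is x₀; compactness of P makes one l > 0 work for all c.
  have hev : ∀ᶠ l : ℝ in 𝓝 0, ∀ c ∈ P, (((1 - l : ℝ) : ℂ) • x₀ + (l : ℂ) • c) ∈ U := by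
    refine hP.eventually_forall_of_forall_eventually fun c _ => ?_
    have hct : Continuous fun z : ℝ × (ℤ → ℂ) => ((1 - z.1 : ℝ) : ℂ) • x₀ + (z.1 : ℂ) • z.2 := by
      fun_prop
    exact hct.continuousAt.eventually (hU.mem_nhds (by simpa using hx₀U))
  obtain ⟨l, hl, hl0, hl1⟩ : ∃ l : ℝ, (∀ c ∈ P, (((1 - l : ℝ) : ℂ) • x₀ + (l : ℂ) • c) ∈ U) ∧
      0 < l ∧ l < 1 := by
    obtain ⟨δ, hδ, hball⟩ := Metric.eventually_nhds_iff.1 hev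
    refine ⟨min (δ / 2) (1 / 2), hball ?_, by positivity, (min_le_right _ _).trans_lt (by norm_num)⟩
    rw [dist_zero_right, Real.norm_of_nonneg (by positivity)]
    exact (min_le_left _ _).trans_lt (half_lt_self hδ)
  obtain ⟨k₀, hk₀, hk₀'⟩ := hUQ x₀ hx₀P hx₀U
  -- From c = l⁻¹ ((1 - l) x₀ + l c) - l⁻¹ (1 - l) x₀, where both terms lift with bound at most l⁻¹
  -- m; adding 1 keeps the constant positive when m = 0.
  refine ⟨l⁻¹ * (2 * m) + 1, m, by positivity, fun c hc hc' => ?_⟩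
  obtain ⟨k₁, hk₁, hk₁'⟩ := hUQ _ (hPconv x₀ hx₀P c ⟨hc, hc'⟩ l hl0.le hl1.le) (hl c ⟨hc, hc'⟩)
  have hlne : (l : ℂ) ≠ 0 := by exact_mod_cast hl0.ne'
  refine ⟨(l : ℂ)⁻¹ • k₁ + (-((l : ℂ)⁻¹ * ((1 - l : ℝ) : ℂ))) • k₀, ?_, ?_⟩
  · refine dualBall_mono (by positivity) ?_ le_rfl (dualBall_smul_add hk₁ hk₀ _ _)
    rw [norm_neg, norm_mul, norm_inv, Complex.norm_real, Complex.norm_real,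
      Real.norm_of_nonneg hl0.le, Real.norm_of_nonneg (by linarith)]
    have h1 : l⁻¹ * (1 - l) * (m : ℝ) ≤ l⁻¹ * 1 * m := by gcongr; linarith
    linarith
  · rw [nonnegPart_smul_add, hk₀', hk₁', smul_add, smul_smul, smul_smul, inv_mul_cancel₀ hlne,
      one_smul, neg_smul]
    abel

theorem AnnihilatorSplits.coeffEstimate {E : Set Circle} (hE : IsClosed E) (hne : E ≠ univ)
    (h : AnnihilatorSplits E) : CoeffEstimate E := by
  refine coeffEstimate_iff.2 fun s => ?_
  obtain ⟨C, t, hC, h⟩ := h.exists_dualBall s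
  refine ⟨C, hC, t, fun T hT M hM hb n => ?_⟩
  -- The case M = 0, where T cannot be normalised, is the uniqueness statement itself.
  rcases hM.eq_or_lt with rfl | hM
  · have : T = 0 := eq_zero_of_mem_annihilators hE hne hT <|
      mem_annihilator_aInf_iff.2 fun n hn => by simpa using hb n hn
    simp [this]
  have hMne : (M : ℂ) ≠ 0 := by exact_mod_cast hM.ne'
  let c : ℤ → ℂ := nonnegPart fun n => (M : ℂ)⁻¹ * T (alphaPow n)
  have hcn : ∀ n : ℤ, 0 ≤ n → c n = (M : ℂ)⁻¹ * T (alphaPow n) := fun n hn => if_pos hn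
  have hcn' : ∀ n : ℤ, ¬ 0 ≤ n → c n = 0 := fun n hn => if_neg hn
  have hcb : ∀ n : ℤ, ‖c n‖ ≤ 1 * (1 + |(n : ℝ)|) ^ (s : ℝ) := fun n => by
    by_cases hn : 0 ≤ n
    · rw [hcn n hn, norm_mul, norm_inv, Complex.norm_real, Real.norm_of_nonneg hM.le, one_mul,
        inv_mul_le_iff₀ hM]
      exact hb n hn
    · rw [hcn' n hn, norm_zero]
      positivity
  -- R is M⁻¹ T with the coefficients of index n < 0 removed. It agrees with M⁻¹ T on a^∞, so it
  -- still kills I_∞^+(E), though it need not kill I_∞(E).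
  obtain ⟨R, hR⟩ := exists_distribution hcb
  have hRT : R - (M : ℂ)⁻¹ • T ∈ annihilator aInf := mem_annihilator_aInf_iff.2 fun n hn => by
    simp [hR, hcn n hn]
  have hRJ : R ∈ annihilator (idealInfPlus E) := fun f hf => by
    have h1 := hRT f hf.2
    rw [_root_.sub_apply, _root_.smul_apply, hT f hf.1, smul_zero, sub_zero] at h1
    exact h1
  obtain ⟨k, ⟨⟨S, hS, hSk⟩, hk⟩, hkc⟩ := h c ⟨⟨R, hRJ, hR⟩, hcb⟩ <| by
    funext n
    by_cases hn : 0 ≤ n <;> simp [c, nonnegPart, hn]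
  -- Both terms kill I_∞(E) and agree on z^n for n ≥ 0, so uniqueness transfers the bound on S at
  -- negative indices to T.
  have h0 : T - (M : ℂ) • S = 0 := by
    refine eq_zero_of_mem_annihilators hE hne
      (Submodule.sub_mem _ hT (Submodule.smul_mem _ _ hS)) (mem_annihilator_aInf_iff.2 fun n hn => ?_)
    have h1 : k n = c n := by rw [← hkc]; exact (if_pos hn).symm
    rw [_root_.sub_apply, _root_.smul_apply, hSk, h1, hcn n hn, smul_eq_mul,
      mul_inv_cancel_left₀ hMne, sub_self]
  rw [sub_eq_zero.1 h0, _root_.smul_apply, hSk, smul_eq_mul, norm_mul, Complex.norm_real,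
    Real.norm_of_nonneg hM.le]
  calc M * ‖k n‖ ≤ M * (C * (1 + |(n : ℝ)|) ^ (t : ℝ)) := by gcongr; exact hk n
    _ = _ := by ring

end CircleInterp

theorem proposition4p2 (E : Set Circle) (hE : IsClosed E) :
    (CircleInterp.IsInterpolationSet E ↔ CircleInterp.CoeffEstimate E) ∧
    (CircleInterp.IsInterpolationSet E → CircleInterp.AnnihilatorSplits E) ∧
    (E ≠ Set.univ →
      (CircleInterp.AnnihilatorSplits E → CircleInterp.IsInterpolationSet E)) :=
  ⟨⟨fun h => h.coeffEstimate, fun h => h.isInterpolationSet⟩, fun h => h.annihilatorSplits,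
    fun hne h => (h.coeffEstimate hE hne).isInterpolationSet⟩
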